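/- Let $n\ge 0$ and let $\mathbf k=(k_1,\dots,k_n)$ be a weak composition of $n$ (nonnegative integers with sum $n$). *Tournaments.* Consider trivalent trees $T$ (finite trees in which every vertex has degree $1$ or $3$, up to label-preserving isomorphism) whose leaves are labeled bijectively by $a<b<c<1<2<\dots<n$. The lazy tournament of $T$ labels the edges of $T$: first each leaf edge gets the label of its leaf; then, until all edges are labeled, one repeats the following round. Among all pairs of labeled edges, with labels $i<j$, that share a vertex whose third edge $E$ is unlabeled, take the pair with the largest $i$; $j$ wins the round and $i$ loses it; $E$ is labeled by $i$ if $E$ is adjacent to an edge with a label $u\ne j$, $u>i$, and by $j$ otherwise. Let $\mathrm{Tour}(\mathbf k)$ be the set of those $T$ in which the leaf edges $a$ and $b$ share a vertex and each label $j\in\{1,\dots,n\}$ wins exactly $k_j$ rounds. *Parking functions.* A parking function of size $n$ is a lattice path from $(0,n)$ to $(n,0)$ with unit steps right and down that stays weakly above the line $x+y=n$, together with a labeling of the squares just to the left of its down steps by the cars $1,\dots,n$, each used once, that increases up each column; columns are numbered $1,\dots,n$ from left to right. For a car $x$ let $d_x$ be the number of columns strictly to the right of $x$ that contain no car greater than $x$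 (empty columns included). Let $\mathrm{CPF}(\mathbf k)$ be the set of parking functions of size $n$ with $d_x<x$ for all cars $x$ and with exactly $k_j$ cars in column $j$ for all $j$. *The maps.* Let $\tau(T)$ be the filling that has car $m$ in column $j$ if and only if label $j$ wins round $m$ of the tournament of $T$. Now let $n\ge1$, let $i$ be the largest index with $k_i=0$ ($i=c$ if there is none), and for $j>i$ let $\widetilde{\mathbf k}_j$ be the weak composition of $n-1$ obtained from $\mathbf k$ by decreasing $k_j$ by $1$ and then deleting the rightmost $0$. For $T\in\mathrm{Tour}(\mathbf k)$ let $i'<j$ be the first pair to face off and $v$ the vertex adjacent to the leaves $i'$ and $j$. If $k_j>1$, $\pi_{\mathrm{lazy}}(T)$ is obtained by labeling $v$ by $j$, removing the leaves $i'$ and $j$ and their edges, and decreasing all labels above $i'$ by $1$; if $k_j=1$, by labeling $v$ by $i'$, removing the leaves $i'$ and $j$ and their edges, and decreasing all labels above $j$ by $1$. It is placed in the summand indexed by $j$. For a parking function $P$, $r(P)$ is obtained by removing car $1$ with its row, decrementing the other cars, and deleting the rightmost empty column; $\hat r(P)$ is $r(P)$ placed in the summand indexed by the column of car $1$ in $P$.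 **Proposition.** For every weak composition $\mathbf k$ of $n$, $\tau$ is a well-defined bijection from $\mathrm{Tour}(\mathbf k)$ to $\mathrm{CPF}(\mathbf k)$. If $n\ge1$, then $\pi_{\mathrm{lazy}}:\mathrm{Tour}(\mathbf k)\to\coprod_{j>i}\mathrm{Tour}(\widetilde{\mathbf k}_j)$ and $\hat r:\mathrm{CPF}(\mathbf k)\to\coprod_{j>i}\mathrm{CPF}(\widetilde{\mathbf k}_j)$ are well-defined, and $\hat r\circ\tau=\bigl(\coprod_{j>i}\tau\bigr)\circ\pi_{\mathrm{lazy}}$. -/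

import Mathlib

/-- The ordered label set `a < b < c < 1 < 2 < ⋯ < n` is modelled by `Fin (n + 3)`:
`a, b, c` are `0, 1, 2`, and the number `j + 1` (for `j : Fin n`) is `num j`. -/
abbrev Label (n : ℕ) : Type := Fin (n + 3)

/-- The numeric label `j + 1`, for `j : Fin n`. -/
def num {n : ℕ} (j : Fin n) : Label n := j.addNat 3

/-- A trivalent tree with leaves labelled by `a, b, c, 1, …, n`: a finite tree all of whose
vertices have degree `1` or `3`, with a bijection from the labels to the vertices of degree `1`.
(As there are at least three leaves, some vertex has degree `3`.) -/
structure TrivalentTree (n : ℕ) where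
  V : Type
  finite : Finite V
  G : SimpleGraph V
  isTree : G.IsTree
  degree : ∀ v, (G.neighborSet v).ncard = 1 ∨ (G.neighborSet v).ncard = 3
  leaf : Label n → V
  leaf_injective : Function.Injective leaf
  leaf_range : ∀ v, (∃ x, leaf x = v) ↔ (G.neighborSet v).ncard = 1

namespace TrivalentTree

variable {n : ℕ}

/-- The leaf edges `a` and `b` share a vertex. -/
def ABShareVertex (T : TrivalentTree n) : Prop :=
  ∃ v, T.G.Adj v (T.leaf 0) ∧ T.G.Adj v (T.leaf 1)

/-- A partial labelling of the edges; `none` means unlabelled. -/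
abbrev EdgeLabeling (T : TrivalentTree n) : Type := Sym2 T.V → Option (Label n)

/-- The labelling at the start of the tournament: exactly the leaf edges are labelled, each by
the label of its leaf. -/
def IsInitial (T : TrivalentTree n) (lab : T.EdgeLabeling) : Prop :=
  ∀ e x, lab e = some x ↔ e ∈ T.G.edgeSet ∧ T.leaf x ∈ e

/-- Two edges labelled `i < j` share a vertex whose third edge `E` is unlabelled. -/
def CanFaceOff (T : TrivalentTree n) (lab : T.EdgeLabeling) (i j : Label n) (E : Sym2 T.V) :
    Prop :=
  i < j ∧ ∃ v, ∃ e ∈ T.G.incidenceSet v, ∃ f ∈ T.G.incidenceSet v,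
    e ≠ f ∧ E ∈ T.G.incidenceSet v ∧ lab e = some i ∧ lab f = some j ∧ lab E = none

/-- The pair `(i, j)` faces off at the edge `E`: among all available pairs, it has the largest
smaller label `i`. -/
def FacesOff (T : TrivalentTree n) (lab : T.EdgeLabeling) (i j : Label n) (E : Sym2 T.V) :
    Prop :=
  T.CanFaceOff lab i j E ∧ ∀ i' j' E', T.CanFaceOff lab i' j' E' → i' ≤ i

/-- The laziness rule applies: `E` is adjacent to an edge with a label `u ≠ j`, `u > i`. -/
def LazinessApplies (T : TrivalentTree n) (lab : T.EdgeLabeling) (i j : Label n)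
    (E : Sym2 T.V) : Prop :=
  ∃ g ∈ T.G.edgeSet, g ≠ E ∧ (∃ w, w ∈ E ∧ w ∈ g) ∧ ∃ u, lab g = some u ∧ u ≠ j ∧ i < u

open Classical in
/-- The labelling after `(i, j)` have faced off at `E`: the loser `i` advances to `E` if the
laziness rule applies, and otherwise the winner `j` advances. -/
noncomputable def advance (T : TrivalentTree n) (lab : T.EdgeLabeling) (i j : Label n)
    (E : Sym2 T.V) : T.EdgeLabeling :=
  fun e => if e = E then some (if T.LazinessApplies lab i j E then i else j) else lab e

/-- `Run lab rs`: starting from `lab`, the process runs until all edges are labelled, and `rs` is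
the list of its rounds in order, each recorded as the pair (loser, winner). -/
inductive Run (T : TrivalentTree n) : T.EdgeLabeling → List (Label n × Label n) → Prop
  | done (lab : T.EdgeLabeling) : (∀ e ∈ T.G.edgeSet, lab e ≠ none) → Run T lab []
  | round (lab : T.EdgeLabeling) (i j : Label n) (E : Sym2 T.V)
      (rs : List (Label n × Label n)) :
      T.FacesOff lab i j E → Run T (T.advance lab i j E) rs → Run T lab ((i, j) :: rs)

/-- `rs` is the list of rounds (loser, winner) of the lazy tournament of `T`. -/
def IsTournament (T : TrivalentTree n) (rs : List (Label n × Label n)) : Prop :=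
  ∃ lab, T.IsInitial lab ∧ T.Run lab rs

/-- The pair `i < j` is the first to face off, and `v` is the vertex adjacent to the leaves `i`
and `j`. -/
def FirstFaceOff (T : TrivalentTree n) (i j : Label n) (v : T.V) : Prop :=
  (∃ lab, T.IsInitial lab ∧ ∃ E, T.FacesOff lab i j E) ∧
    T.G.Adj v (T.leaf i) ∧ T.G.Adj v (T.leaf j)

open Classical in
/-- `T'` is the tree formed from `T` by giving the vertex `v` the label `keep`, removing the
leaves `keep` and `drop` together with their edges, and decreasing all labels above `drop` by one.
The map `φ` is the inclusion of what is left; the label `y` of `T'` was `drop.succAbove y`, that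
is, `y` or `y + 1`, before the decrease. -/
def IsPruning (T : TrivalentTree (n + 1)) (v : T.V) (keep drop : Label (n + 1))
    (T' : TrivalentTree n) : Prop :=
  ∃ φ : T'.G ↪g T.G, Set.range φ = {w | w ≠ T.leaf keep ∧ w ≠ T.leaf drop} ∧
    ∀ y : Label n, φ (T'.leaf y) =
      if drop.succAbove y = keep then v else T.leaf (drop.succAbove y)

/-- `T'` is formed from `T` as in the definition of the map `π_lazy` for `k`, where `j` is the
winner of the first round: the vertex `v` next to the leaves `i` and `j` of the first pair gets
label `j` if `k_j > 1` and label `i` otherwise. -/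
def IsPiLazy (k : Fin (n + 1) → ℕ) (T : TrivalentTree (n + 1)) (j : Fin (n + 1))
    (T' : TrivalentTree n) : Prop :=
  ∃ i v, T.FirstFaceOff i (num j) v ∧
    if 1 < k j then T.IsPruning v (num j) i T' else T.IsPruning v i (num j) T'

/-- Isomorphism of leaf-labelled trees. -/
instance setoid (n : ℕ) : Setoid (TrivalentTree n) where
  r T T' := ∃ φ : T.G ≃g T'.G, ∀ x, φ (T.leaf x) = T'.leaf x
  iseqv :=
    { refl := fun T => ⟨RelIso.refl _, fun _ => rfl⟩
      symm := fun ⟨φ, h⟩ => ⟨φ.symm, fun x => by rw [← h x]; exact φ.symm_apply_apply _⟩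
      trans := fun ⟨φ, h⟩ ⟨ψ, h'⟩ => ⟨φ.trans ψ, fun x => by rw [← h' x, ← h x]; rfl⟩ }

/-! The tournament does not change under isomorphism. -/

section Invariance

variable {T T' : TrivalentTree n} {lab : T.EdgeLabeling} {lab' : T'.EdgeLabeling}
  {i j : Label n} {E : Sym2 T.V}

theorem map_mem_edgeSet (φ : T.G ≃g T'.G) {e : Sym2 T.V} (h : e ∈ T.G.edgeSet) :
    e.map φ ∈ T'.G.edgeSet := by
  induction e with
  | _ x y => exact φ.map_adj_iff.2 h

theorem map_mem_incidenceSet (φ : T.G ≃g T'.G) {e : Sym2 T.V} {v : T.V}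
    (h : e ∈ T.G.incidenceSet v) : e.map φ ∈ T'.G.incidenceSet (φ v) :=
  ⟨map_mem_edgeSet φ h.1, Sym2.mem_map.2 ⟨v, h.2, rfl⟩⟩

theorem symm_map_map (φ : T.G ≃g T'.G) (e : Sym2 T.V) : (e.map φ).map φ.symm = e := by
  induction e with
  | _ x y => simp

theorem map_symm_map (φ : T.G ≃g T'.G) (e : Sym2 T'.V) : (e.map φ.symm).map φ = e :=
  symm_map_map φ.symm e

theorem CanFaceOff.map (φ : T.G ≃g T'.G) (hlab : ∀ e, lab' (e.map φ) = lab e)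
    (h : T.CanFaceOff lab i j E) : T'.CanFaceOff lab' i j (E.map φ) := by
  obtain ⟨hij, v, e, he, f, hf, hef, hE, h1, h2, h3⟩ := h
  refine ⟨hij, φ v, e.map φ, map_mem_incidenceSet φ he, f.map φ, map_mem_incidenceSet φ hf, ?_,
    map_mem_incidenceSet φ hE, ?_, ?_, ?_⟩
  · exact fun h => hef (Sym2.map.injective φ.injective h)
  all_goals rw [hlab]; assumption

theorem LazinessApplies.map (φ : T.G ≃g T'.G) (hlab : ∀ e, lab' (e.map φ) = lab e)
    (h : T.LazinessApplies lab i j E) : T'.LazinessApplies lab' i j (E.map φ) := by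
  obtain ⟨g, hg, hgE, ⟨w, hw, hw'⟩, u, hu, h1, h2⟩ := h
  refine ⟨g.map φ, map_mem_edgeSet φ hg, fun h => hgE (Sym2.map.injective φ.injective h),
    ⟨φ w, Sym2.mem_map.2 ⟨w, hw, rfl⟩, Sym2.mem_map.2 ⟨w, hw', rfl⟩⟩, u, ?_, h1, h2⟩
  rw [hlab]; exact hu

theorem symm_lab (φ : T.G ≃g T'.G) (hlab : ∀ e, lab' (e.map φ) = lab e) (e : Sym2 T'.V) :
    lab (e.map φ.symm) = lab' e := by
  rw [← hlab, map_symm_map]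

theorem FacesOff.map (φ : T.G ≃g T'.G) (hlab : ∀ e, lab' (e.map φ) = lab e)
    (h : T.FacesOff lab i j E) : T'.FacesOff lab' i j (E.map φ) :=
  ⟨h.1.map φ hlab, fun i' j' _ h' => h.2 i' j' _ (h'.map φ.symm (symm_lab φ hlab))⟩

theorem advance_map (φ : T.G ≃g T'.G) (hlab : ∀ e, lab' (e.map φ) = lab e) (e : Sym2 T.V) :
    T'.advance lab' i j (E.map φ) (e.map φ) = T.advance lab i j E e := by
  have h1 : e.map φ = E.map φ ↔ e = E := (Sym2.map.injective φ.injective).eq_iff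
  have h2 : T'.LazinessApplies lab' i j (E.map φ) ↔ T.LazinessApplies lab i j E :=
    ⟨fun h => by simpa only [symm_map_map] using h.map φ.symm (symm_lab φ hlab),
      fun h => h.map φ hlab⟩
  unfold advance
  rw [hlab]
  by_cases he : e = E <;> by_cases hl : T.LazinessApplies lab i j E <;>
    simp only [if_pos, if_neg, he, hl, mt h1.1, h2.2, mt h2.1, not_false_eq_true]

theorem Run.map (φ : T.G ≃g T'.G) {rs : List (Label n × Label n)} (h : T.Run lab rs) :
    ∀ lab' : T'.EdgeLabeling, (∀ e, lab' (e.map φ) = lab e) → T'.Run lab' rs := by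
  induction h with
  | done lab h =>
    intro lab' hlab
    refine Run.done _ fun e he => ?_
    rw [← symm_lab φ hlab]
    exact h _ (map_mem_edgeSet φ.symm he)
  | round lab i j E rs h _ ih =>
    intro lab' hlab
    exact Run.round _ i j (E.map φ) rs (h.map φ hlab) (ih _ (advance_map φ hlab))

theorem IsInitial.map (φ : T.G ≃g T'.G) (hφ : ∀ x, φ (T.leaf x) = T'.leaf x)
    (h : T.IsInitial lab) : T'.IsInitial fun e => lab (e.map φ.symm) := by
  intro e x
  rw [h, ← hφ]
  refine and_congr ⟨fun h => ?_, map_mem_edgeSet φ.symm⟩ ⟨fun h => ?_, fun h => ?_⟩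
  · simpa only [map_symm_map] using map_mem_edgeSet φ h
  · rw [← map_symm_map φ e]; exact Sym2.mem_map.2 ⟨_, h, rfl⟩
  · exact Sym2.mem_map.2 ⟨_, h, φ.symm_apply_apply _⟩

theorem IsTournament.of_equiv {rs : List (Label n × Label n)} (hT : T ≈ T')
    (h : T.IsTournament rs) : T'.IsTournament rs := by
  obtain ⟨φ, hφ⟩ := hT
  obtain ⟨lab, h0, h⟩ := h
  exact ⟨_, h0.map φ hφ, h.map φ _ fun e => by rw [symm_map_map]⟩

theorem ABShareVertex.of_equiv (hT : T ≈ T') (h : T.ABShareVertex) : T'.ABShareVertex := by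
  obtain ⟨φ, hφ⟩ := hT
  obtain ⟨v, h1, h2⟩ := h
  exact ⟨φ v, by rw [← hφ]; exact φ.map_adj_iff.2 h1, by rw [← hφ]; exact φ.map_adj_iff.2 h2⟩

end Invariance

end TrivalentTree

/-- Leaf-labelled trivalent trees up to isomorphism. -/
def TreeClass (n : ℕ) : Type 1 := Quotient (TrivalentTree.setoid n)

namespace TreeClass

variable {n : ℕ}

/-- The leaf edges `a` and `b` share a vertex. -/
def ABShareVertex (T : TreeClass n) : Prop :=
  Quotient.lift TrivalentTree.ABShareVertex
    (fun _ _ h => propext ⟨fun h' => h'.of_equiv h, fun h' => h'.of_equiv (Setoid.symm h)⟩) T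

/-- `rs` is the list of rounds (loser, winner) of the lazy tournament of `T`. -/
def IsTournament (T : TreeClass n) (rs : List (Label n × Label n)) : Prop :=
  Quotient.lift (fun A : TrivalentTree n => A.IsTournament rs)
    (fun _ _ h => propext ⟨fun h' => h'.of_equiv h, fun h' => h'.of_equiv (Setoid.symm h)⟩) T

/-- Label `j + 1` wins round `m + 1` of the tournament of `T`. -/
def WinsRound (T : TreeClass n) (j : Fin n) (m : ℕ) : Prop :=
  ∃ rs, T.IsTournament rs ∧ ∃ i, rs[m]? = some (i, num j)

/-- `(j, T')` is the value of `π_lazy` at `T ∈ Tour k`: `T'` is formed from `T` as described in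
`TrivalentTree.IsPiLazy`, and lies in the summand indexed by the winner `j` of the first round. -/
def IsPiLazy (k : Fin (n + 1) → ℕ) (T : TreeClass (n + 1)) (j : Fin (n + 1)) (T' : TreeClass n) : Prop :=
  ∃ (A : TrivalentTree (n + 1)) (B : TrivalentTree n),
    (Quotient.mk _ A : TreeClass (n + 1)) = T ∧ (Quotient.mk _ B : TreeClass n) = T' ∧ A.IsPiLazy k j B

end TreeClass

/-- `Tour(k)`: the trees in which the leaf edges `a`, `b` share a vertex and each numeric label
`j` wins exactly `k_j` rounds of the tournament. -/
def Tour {n : ℕ} (k : Fin n → ℕ) : Set (TreeClass n) :=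
  {T | T.ABShareVertex ∧
    ∃ rs, T.IsTournament rs ∧ ∀ j, rs.countP (fun p => p.2 = num j) = k j}

/-- The greatest index with property `p` (only used when there is one). -/
noncomputable def rightmost {n : ℕ} (p : Fin (n + 1) → Prop) [DecidablePred p] : Fin (n + 1) :=
  (Finset.univ.filter p).sup id

/-- `j > i`, where `i` is the largest index with `k_i = 0`, or `i = c` if there is none. -/
def AboveZeros {n : ℕ} (k : Fin n → ℕ) (j : Fin n) : Prop := ∀ l, k l = 0 → l < j

/-- The composition `k̃_j`: decrease `k_j` by one, then remove the rightmost zero. -/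
noncomputable def tilde {n : ℕ} (k : Fin (n + 1) → ℕ) (j : Fin (n + 1)) : Fin n → ℕ :=
  let k' := Function.update k j (k j - 1)
  fun x => k' ((rightmost fun c => k' c = 0).succAbove x)

/-- A filling of the `n` columns of the `n × n` box with the labels (cars) `1, …, n`, one in each
row: `P m` is the column of car `m + 1`, columns being numbered `0, …, n - 1` from left to right. As
the cars in a column increase upwards, the columns of the cars determine the whole picture. -/
abbrev Filling (n : ℕ) : Type := Fin n → Fin n

namespace Filling

variable {n : ℕ}

/-- The number of cars in a column, which is the number of down steps on its right side. -/
def height (P : Filling n) (c : Fin n) : ℕ := (Finset.univ.filter fun m => P m = c).card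

/-- `P` is a parking function: the lattice path from `(0, n)` that makes, for each column from left
to right, one right step and then as many down steps as the column has cars, stays weakly above
the line `x + y = n`. After column `c` the path is at the point
`(c + 1, n - ∑ c' ≤ c, height c')`. -/
def IsParking (P : Filling n) : Prop :=
  ∀ c : Fin n, ∑ c' ∈ Finset.Iic c, P.height c' ≤ c.val + 1

/-- Car `x` dominates the column `c`: it lies to the right of `x` and has no car greater than
`x`. -/
def Dominates (P : Filling n) (x c : Fin n) : Prop := P x < c ∧ ∀ y, P y = c → ¬ x < y

open Classical in
/-- The dominance index of the car `x + 1`. -/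
noncomputable def dominanceIndex (P : Filling n) (x : Fin n) : ℕ :=
  (Finset.univ.filter fun c => P.Dominates x c).card

def IsColumnRestricted (P : Filling n) : Prop := ∀ x : Fin n, P.dominanceIndex x < x.val + 1

/-- The rightmost column that is empty once car `1` has been removed. -/
noncomputable def rightmostEmpty (P : Filling (n + 1)) : Fin (n + 1) :=
  rightmost fun c => ∀ m : Fin n, P m.succ ≠ c

theorem ne_rightmostEmpty (P : Filling (n + 1)) (m : Fin n) : P m.succ ≠ P.rightmostEmpty := by
  have hne : (Finset.univ.filter fun c => ∀ m : Fin n, P m.succ ≠ c).Nonempty := by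
    by_contra h
    rw [Finset.not_nonempty_iff_eq_empty, Finset.filter_eq_empty_iff] at h
    have hs : Function.Surjective fun m : Fin n => P m.succ := fun c => by
      simpa using h (Finset.mem_univ c)
    simpa using Fintype.card_le_of_surjective _ hs
  obtain ⟨c, hc, h⟩ := Finset.exists_mem_eq_sup _ hne id
  have : P.rightmostEmpty = c := h
  rw [this]
  exact (Finset.mem_filter.1 hc).2 m

/-- The map `r`: remove car `1` and decrement the other cars, then delete the rightmost empty
column, so that the columns to its right move one step to the left. -/
noncomputable def r (P : Filling (n + 1)) : Filling n :=
  fun m => (finSuccAboveEquiv P.rightmostEmpty).symm ⟨P m.succ, P.ne_rightmostEmpty m⟩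

end Filling

/-- `CPF(k)`: the column-restricted parking functions with `k_c` cars in each column `c`. -/
def CPF {n : ℕ} (k : Fin n → ℕ) : Set (Filling n) :=
  {P | P.IsParking ∧ P.IsColumnRestricted ∧ ∀ c, P.height c = k c}

/-- The map `τ`: car `m` is in column `j` iff label `j` wins round `m` of the tournament. -/
noncomputable def tau {n : ℕ} (T : TreeClass n) : Filling n :=
  fun m => @Classical.epsilon (Fin n) ⟨m⟩ fun j => T.WinsRound j m

/-!
Pruning the first cherry of the tournament corresponds to removing car `1`. The rounds after the
first are those of the pruned tree: if the winner of the first round advances but does not win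
again, it makes no difference to them whether it carries its own label or that of the loser. The
first loser `i` never wins a round and every larger label does, so `i` is the last zero of the
composition. The winner of the first round is the column of car `1`. Hence a parking function `P`
determines which cherry to graft onto the tree of `r P`, and `τ` is a bijection by induction on `n`.
-/

section Graph

variable {V : Type*} {G : SimpleGraph V}

theorem mem_of_preconnected_of_adj_closed (hG : G.Preconnected) {S : Set V} {a : V} (ha : a ∈ S)
    (hS : ∀ x ∈ S, ∀ y, G.Adj x y → y ∈ S) (x : V) : x ∈ S := by
  obtain ⟨p⟩ := hG a x
  induction p with
  | nil => exact ha
  | cons h _ ih => exact ih (hS _ ha _ h)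

theorem map_mem_incidenceSet_of_embedding {V' : Type*} {G' : SimpleGraph V'} (φ : G ↪g G') {v : V}
    {e : Sym2 V} (he : e ∈ G.incidenceSet v) : e.map φ ∈ G'.incidenceSet (φ v) :=
  ⟨φ.map_mem_edgeSet_iff.2 he.1, Sym2.mem_map.2 ⟨v, he.2, rfl⟩⟩

theorem ncard_neighborSet_of_embedding {V' : Type*} {G' : SimpleGraph V'} (φ : G ↪g G') {v : V}
    (h : G'.neighborSet (φ v) ⊆ Set.range φ) :
    (G.neighborSet v).ncard = (G'.neighborSet (φ v)).ncard := by
  rw [← Set.ncard_image_of_injective _ φ.injective]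
  congr 1
  refine subset_antisymm ?_ fun t ht => ?_
  · rintro _ ⟨t, ht, rfl⟩
    exact φ.map_adj_iff.2 ht
  · obtain ⟨t, rfl⟩ := h ht
    exact ⟨t, φ.map_adj_iff.1 ht, rfl⟩

theorem connected_induce_of_adj_eq (hG : G.Connected) {S : Set V} {v : V} (hv : v ∈ S)
    (h : ∀ x ∉ S, ∀ y, G.Adj x y → y = v) : (G.induce S).Connected := by
  have hreach : ∀ x (hx : x ∈ S), (G.induce S).Reachable ⟨v, hv⟩ ⟨x, hx⟩ := by
    refine mem_of_preconnected_of_adj_closed hG.preconnected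
      (S := {x | ∀ hx : x ∈ S, (G.induce S).Reachable ⟨v, hv⟩ ⟨x, hx⟩}) (a := v)
      (fun _ => .refl _) fun x hx y hxy hy => ?_
    by_cases hxS : x ∈ S
    · exact (hx hxS).trans (SimpleGraph.Adj.reachable (by exact hxy))
    · obtain rfl := h x hxS y hxy
      rfl
  have : Nonempty S := ⟨⟨v, hv⟩⟩
  exact ⟨fun x y => (hreach x x.2).symm.trans (hreach y y.2)⟩

theorem ncard_neighborSet_starGraph_self [Finite V] (r : V) :
    ((SimpleGraph.starGraph r).neighborSet r).ncard = Nat.card V - 1 := by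
  classical
  have := Fintype.ofFinite V
  rw [Set.ncard_eq_toFinset_card', ← SimpleGraph.neighborFinset_def,
    SimpleGraph.card_neighborFinset_eq_degree, SimpleGraph.degree_starGraph_center,
    Nat.card_eq_fintype_card]

theorem ncard_neighborSet_starGraph_of_ne {r v : V} (h : v ≠ r) :
    ((SimpleGraph.starGraph r).neighborSet v).ncard = 1 := by
  refine Set.ncard_eq_one.2 ⟨r, Set.ext fun u => ?_⟩
  simp only [SimpleGraph.mem_neighborSet, SimpleGraph.starGraph_adj, Set.mem_singleton_iff]
  grind

end Graph

theorem exists_eq_triple_of_ncard_eq_three {α : Type*} {s : Set α} (hs : s.ncard = 3) {a b : α}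
    (ha : a ∈ s) (hb : b ∈ s) (hab : a ≠ b) : ∃ c, c ≠ a ∧ c ≠ b ∧ s = {a, b, c} := by
  have hsub : {a, b} ⊆ s := Set.pair_subset ha hb
  obtain ⟨c, hc⟩ : ∃ c, s \ {a, b} = {c} := by
    rw [← Set.ncard_eq_one, Set.ncard_sdiff hsub, hs, Set.ncard_pair hab]
  obtain ⟨-, hcab⟩ : c ∈ s \ {a, b} := hc ▸ rfl
  rw [Set.mem_insert_iff, Set.mem_singleton_iff, not_or] at hcab
  exact ⟨c, hcab.1, hcab.2, by rw [← Set.sdiff_union_of_subset hsub, hc]; ext; simp⟩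

section SuccAbove

variable {n : ℕ}

theorem val_le_val_succAbove (p : Fin (n + 1)) (x : Fin n) : x.val ≤ (p.succAbove x).val := by
  unfold Fin.succAbove
  split_ifs <;> simp

theorem val_succAbove_lt_iff_of_le {z : Fin (n + 1)} {x : Fin n} {c : ℕ} (hc : c ≤ z.val) :
    (z.succAbove x).val < c ↔ x.val < c := by
  simp only [Fin.succAbove, Fin.lt_def]
  split_ifs <;> grind

theorem val_succAbove_lt_succ_iff_of_le {z : Fin (n + 1)} {x : Fin n} {c : ℕ} (hc : z.val ≤ c) :
    (z.succAbove x).val < c + 1 ↔ x.val < c := by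
  simp only [Fin.succAbove, Fin.lt_def]
  split_ifs <;> grind

end SuccAbove

theorem ne_and_eq_none_of_update_eq_none {α β : Type*} [DecidableEq α] {f : α → Option β}
    {a b : α} {c : β} (h : Function.update f a (some c) b = none) : b ≠ a ∧ f b = none := by
  have hb : b ≠ a := by
    rintro rfl
    simp at h
  exact ⟨hb, by rwa [Function.update_of_ne hb] at h⟩

theorem exists_label_notMem {n : ℕ} {s : Finset (Label n)} (hs : s.card < n + 3) : ∃ x, x ∉ s := by
  obtain ⟨x, -, hx⟩ := Finset.exists_mem_notMem_of_card_lt_card (s := s) (t := Finset.univ)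
    (by rwa [Finset.card_univ, Fintype.card_fin])
  exact ⟨x, hx⟩

theorem isGreatest_rightmost {n : ℕ} {p : Fin (n + 1) → Prop} [DecidablePred p] (h : ∃ c, p c) :
    IsGreatest {c | p c} (rightmost p) := by
  obtain ⟨c, hc⟩ := h
  refine ⟨?_, fun d hd => Finset.le_sup (f := id) (Finset.mem_filter.2 ⟨Finset.mem_univ d, hd⟩)⟩
  obtain ⟨d, hd, hde⟩ := Finset.sup_mem_of_nonempty (f := id)
    (⟨c, Finset.mem_filter.2 ⟨Finset.mem_univ c, hc⟩⟩ : (Finset.univ.filter p).Nonempty)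
  rw [rightmost, ← hde]
  exact (Finset.mem_filter.1 hd).2

namespace Filling

variable {n : ℕ}

theorem isGreatest_rightmostEmpty (P : Filling (n + 1)) :
    IsGreatest {c | ∀ m : Fin n, P m.succ ≠ c} P.rightmostEmpty :=
  isGreatest_rightmost ⟨_, P.ne_rightmostEmpty⟩

theorem height_eq_zero_iff {P : Filling n} {c : Fin n} : P.height c = 0 ↔ ∀ m, P m ≠ c := by
  simp [height, Finset.filter_eq_empty_iff]

theorem height_eq_add (P : Filling (n + 1)) (c : Fin (n + 1)) :
    P.height c = (if P 0 = c then 1 else 0) +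
      (Finset.univ.filter fun m : Fin n => P m.succ = c).card := by
  rw [height, Finset.card_filter, Finset.card_filter, Fin.sum_univ_succ]

theorem update_height_eq (P : Filling (n + 1)) (c : Fin (n + 1)) :
    Function.update P.height (P 0) (P.height (P 0) - 1) c =
      (Finset.univ.filter fun m : Fin n => P m.succ = c).card := by
  rcases eq_or_ne c (P 0) with rfl | hc
  · rw [Function.update_self, height_eq_add, if_pos rfl, Nat.add_sub_cancel_left]
  · rw [Function.update_of_ne hc, height_eq_add, if_neg hc.symm, zero_add]

theorem update_height_eq_zero_iff {P : Filling (n + 1)} {c : Fin (n + 1)} :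
    Function.update P.height (P 0) (P.height (P 0) - 1) c = 0 ↔ ∀ m : Fin n, P m.succ ≠ c := by
  simp [update_height_eq, Finset.filter_eq_empty_iff]

theorem rightmostEmpty_eq (P : Filling (n + 1)) :
    P.rightmostEmpty =
      rightmost fun c => Function.update P.height (P 0) (P.height (P 0) - 1) c = 0 := by
  unfold rightmostEmpty
  simp only [update_height_eq_zero_iff]

theorem succAbove_r (P : Filling (n + 1)) (m : Fin n) :
    P.rightmostEmpty.succAbove (P.r m) = P m.succ :=
  congrArg Subtype.val ((finSuccAboveEquiv P.rightmostEmpty).apply_symm_apply _)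

theorem height_r (P : Filling (n + 1)) : P.r.height = tilde P.height (P 0) := by
  ext c
  simp only [tilde, ← rightmostEmpty_eq]
  rw [update_height_eq]
  simp only [height, ← P.succAbove_r, Fin.succAbove_right_inj]

theorem exists_r_eq (P : Filling (n + 1)) {c : Fin n} (hc : P.rightmostEmpty ≤ c.castSucc) :
    ∃ m, P.r m = c := by
  by_contra! h
  have hlt : c.castSucc < P.rightmostEmpty.succAbove c := by
    rw [Fin.succAbove_of_le_castSucc _ _ hc]
    exact c.castSucc_lt_succ
  refine (hc.trans_lt hlt).not_ge (P.isGreatest_rightmostEmpty.2 fun m => ?_)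
  rw [← P.succAbove_r m, Fin.succAbove_right_injective.ne_iff]
  exact h m

section ColumnRestricted

theorem dominates_succ_rightmostEmpty_iff {P : Filling (n + 1)} {m : Fin n} :
    P.Dominates m.succ P.rightmostEmpty ↔ P m.succ < P.rightmostEmpty := by
  refine and_iff_left (Fin.cases (fun _ => Fin.not_lt_zero _) fun y hy => ?_)
  exact absurd hy (P.ne_rightmostEmpty y)

theorem dominates_succ_succAbove_iff {P : Filling (n + 1)} {m c : Fin n} :
    P.Dominates m.succ (P.rightmostEmpty.succAbove c) ↔ P.r.Dominates m c := by
  simp only [Dominates, Fin.forall_fin_succ, ← P.succAbove_r, Fin.succAbove_lt_succAbove_iff,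
    Fin.succAbove_right_inj, Fin.succ_lt_succ_iff, Fin.not_lt_zero, not_false_eq_true,
    implies_true, true_and]

theorem dominanceIndex_succ (P : Filling (n + 1)) (m : Fin n) :
    P.dominanceIndex m.succ =
      (if P m.succ < P.rightmostEmpty then 1 else 0) + P.r.dominanceIndex m := by
  classical
  simp only [dominanceIndex, Finset.card_filter, Fin.sum_univ_succAbove _ P.rightmostEmpty,
    dominates_succ_rightmostEmpty_iff, dominates_succ_succAbove_iff]

/-- Every column that `m` dominates contains a car, and that car is smaller than `m`. -/
theorem dominanceIndex_r_le (P : Filling (n + 1)) {m : Fin n}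
    (hm : P.rightmostEmpty ≤ P m.succ) : P.r.dominanceIndex m ≤ m.val := by
  classical
  have hsub : (Finset.univ.filter fun c => P.r.Dominates m c) ⊆ (Finset.Iio m).image P.r := by
    intro c hc
    obtain ⟨hlt, hdom⟩ := (Finset.mem_filter.1 hc).2
    have hle : P.rightmostEmpty ≤ c.castSucc := by
      rw [← Fin.lt_succAbove_iff_le_castSucc]
      refine hm.trans_lt ?_
      rwa [← P.succAbove_r, Fin.succAbove_lt_succAbove_iff]
    obtain ⟨y, rfl⟩ := P.exists_r_eq hle
    refine Finset.mem_image_of_mem _ (Finset.mem_Iio.2 ((not_lt.1 (hdom y rfl)).lt_of_ne ?_))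
    rintro rfl
    exact hlt.false
  exact ((Finset.card_le_card hsub).trans Finset.card_image_le).trans_eq (Fin.card_Iio m)

theorem dominanceIndex_succ_lt_iff {P : Filling (n + 1)} {m : Fin n} :
    P.dominanceIndex m.succ < m.succ.val + 1 ↔ P.r.dominanceIndex m < m.val + 1 := by
  rw [dominanceIndex_succ, Fin.val_succ]
  split_ifs with h
  · omega
  · have := P.dominanceIndex_r_le (not_lt.1 h)
    omega

theorem dominanceIndex_zero_eq_zero_iff {P : Filling (n + 1)} :
    P.dominanceIndex 0 = 0 ↔ AboveZeros P.height (P 0) := by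
  simp only [dominanceIndex, Finset.card_eq_zero, Finset.filter_eq_empty_iff, Finset.mem_univ,
    true_imp_iff, AboveZeros, height_eq_zero_iff]
  refine forall_congr' fun c => ⟨fun h hc => ?_, fun h => ?_⟩
  · by_contra hlt
    exact h ⟨(not_lt.1 hlt).lt_of_ne (hc 0), fun y hy => absurd hy (hc y)⟩
  · rintro ⟨hlt, hc⟩
    refine (h fun m hm => ?_).not_gt hlt
    obtain rfl : m = 0 := not_not.1 (mt Fin.pos_iff_ne_zero.2 (hc m hm))
    exact hlt.ne hm

theorem isColumnRestricted_iff {P : Filling (n + 1)} :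
    P.IsColumnRestricted ↔ AboveZeros P.height (P 0) ∧ P.r.IsColumnRestricted := by
  simp only [IsColumnRestricted, Fin.forall_fin_succ, dominanceIndex_succ_lt_iff,
    Fin.val_zero, zero_add, Nat.lt_one_iff, dominanceIndex_zero_eq_zero_iff]

end ColumnRestricted

section Parking

theorem isParking_iff {P : Filling n} :
    P.IsParking ↔ ∀ c : ℕ, (Finset.univ.filter fun m => (P m).val < c).card ≤ c := by
  have hsum : ∀ c : Fin n, ∑ c' ∈ Finset.Iic c, P.height c' =
      (Finset.univ.filter fun m => (P m).val < c.val + 1).card := fun c => by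
    simp only [height, Finset.card_filter]
    rw [Finset.sum_comm]
    simp only [Finset.sum_ite_eq, Finset.mem_Iic, Fin.le_def, Nat.lt_succ_iff]
  simp only [IsParking, hsum]
  refine ⟨fun h c => ?_, fun h c => h (c.val + 1)⟩
  rcases c with - | c
  · simp
  rcases lt_or_ge c n with hc | hc
  · exact h ⟨c, hc⟩
  · exact (Finset.card_le_univ _).trans (by simpa using hc.trans c.le_succ)

theorem card_lt_eq_add (P : Filling (n + 1)) (c : ℕ) :
    (Finset.univ.filter fun m => (P m).val < c).card = (if (P 0).val < c then 1 else 0) +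
      (Finset.univ.filter fun m => (P.rightmostEmpty.succAbove (P.r m)).val < c).card := by
  simp only [Finset.card_filter, Fin.sum_univ_succ, succAbove_r]

theorem card_r_lt_le (P : Filling (n + 1)) {c : ℕ} (hc : P.rightmostEmpty.val ≤ c) :
    (Finset.univ.filter fun m => (P.r m).val < c).card ≤ c := by
  have hsub : (Finset.univ.filter fun d : Fin n => ¬ d.val < c) ⊆
      (Finset.univ.filter fun m => ¬ (P.r m).val < c).image P.r := by
    intro d hd
    have hcd := (Finset.mem_filter.1 hd).2
    obtain ⟨m, rfl⟩ := P.exists_r_eq (Fin.le_def.2 (hc.trans (not_lt.1 hcd)))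
    exact Finset.mem_image_of_mem _ (Finset.mem_filter.2 ⟨Finset.mem_univ m, hcd⟩)
  have hle := (Finset.card_le_card hsub).trans Finset.card_image_le
  have hr := Finset.card_filter_add_card_filter_not (s := Finset.univ) fun m => (P.r m).val < c
  have hd := Finset.card_filter_add_card_filter_not (s := Finset.univ) fun d : Fin n => d.val < c
  rw [Fin.card_filter_val_lt] at hd
  omega

theorem isParking_r_iff {P : Filling (n + 1)} (hz : P.rightmostEmpty ≤ P 0) :
    P.r.IsParking ↔ P.IsParking := by
  rw [isParking_iff, isParking_iff]
  have hbelow : ∀ c : ℕ, c ≤ P.rightmostEmpty.val →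
      (Finset.univ.filter fun m => (P m).val < c).card =
        (Finset.univ.filter fun m => (P.r m).val < c).card := fun c hc => by
    rw [card_lt_eq_add, if_neg (hc.trans hz).not_gt, zero_add]
    simp only [val_succAbove_lt_iff_of_le hc]
  constructor <;> intro h c
  · rcases le_or_gt c P.rightmostEmpty.val with hc | hc
    · exact (hbelow c hc).trans_le (h c)
    · obtain ⟨c, rfl⟩ := Nat.exists_eq_add_one_of_ne_zero (Nat.ne_zero_of_lt hc)
      rw [card_lt_eq_add]
      simp only [val_succAbove_lt_succ_iff_of_le (Nat.lt_succ_iff.1 hc)]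
      have := h c
      split_ifs <;> omega
  · rcases le_or_gt c P.rightmostEmpty.val with hc | hc
    · exact (hbelow c hc).symm.trans_le (h c)
    · exact P.card_r_lt_le hc.le

end Parking

theorem rightmostEmpty_le_of_aboveZeros {P : Filling (n + 1)} (h : AboveZeros P.height (P 0)) :
    P.rightmostEmpty ≤ P 0 := by
  by_contra! hlt
  exact (h _ (height_eq_zero_iff.2 (Fin.cases hlt.ne P.ne_rightmostEmpty))).not_gt hlt

theorem mem_CPF_iff {k : Fin n → ℕ} {P : Filling n} :
    P ∈ CPF k ↔ P.IsParking ∧ P.IsColumnRestricted ∧ P.height = k := by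
  simp only [CPF, Set.mem_ofPred_eq, funext_iff]

theorem mem_CPF_succ_iff {P : Filling (n + 1)} :
    P ∈ CPF P.height ↔ AboveZeros P.height (P 0) ∧ P.r ∈ CPF (tilde P.height (P 0)) := by
  simp only [mem_CPF_iff, P.height_r, and_true, isColumnRestricted_iff]
  constructor
  · rintro ⟨hp, ha, hr⟩
    exact ⟨ha, (isParking_r_iff (rightmostEmpty_le_of_aboveZeros ha)).2 hp, hr⟩
  · rintro ⟨ha, hp, hr⟩
    exact ⟨(isParking_r_iff (rightmostEmpty_le_of_aboveZeros ha)).1 hp, ha, hr⟩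

end Filling

section Num

variable {n : ℕ}

theorem val_num (j : Fin n) : (num j).val = j.val + 3 := rfl

theorem num_injective : Function.Injective (num : Fin n → Label n) := fun a b h => by
  simpa [Fin.ext_iff, val_num] using h

theorem num_lt_num {a b : Fin n} : num a < num b ↔ a < b := by
  simp only [Fin.lt_def, val_num, Nat.add_lt_add_iff_right]

theorem exists_num_eq {x : Label n} (h : 3 ≤ x.val) : ∃ j, num j = x :=
  ⟨⟨x.val - 3, by omega⟩, Fin.ext (Nat.sub_add_cancel h)⟩

theorem succAbove_num (z : Fin (n + 1)) (x : Fin n) :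
    (num z).succAbove (num x) = num (z.succAbove x) := by
  ext
  simp only [Fin.succAbove, Fin.lt_def, Fin.val_castSucc, val_num]
  split_ifs <;> simp only [Fin.val_castSucc, Fin.val_succ, val_num] <;> omega

end Num

section LastZero

variable {n : ℕ} {k : Fin n → ℕ} {i i' : Label n} {j z : Fin n}

/-- `i` is the largest index with `k_i = 0`, or `c` if there is none. -/
structure IsLastZero (k : Fin n → ℕ) (i : Label n) : Prop where
  two_le : 2 ≤ i.val
  eq_zero : ∀ l, num l = i → k l = 0
  ne_zero : ∀ l, i < num l → k l ≠ 0

theorem exists_isLastZero (k : Fin n → ℕ) : ∃ i, IsLastZero k i := by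
  obtain ⟨i, hi, hmax⟩ := Set.exists_max_image {i : Label n | i.val = 2 ∨ ∃ l, num l = i ∧ k l = 0}
    id (Set.toFinite _) ⟨⟨2, by omega⟩, Or.inl rfl⟩
  refine ⟨i, hmax ⟨2, by omega⟩ (Or.inl rfl), ?_, fun l hl h => ?_⟩
  · rintro l rfl
    rcases hi with hi | ⟨l', hl', h⟩
    · simp [val_num] at hi
    · rwa [num_injective hl'] at h
  · exact hl.not_ge (hmax _ (Or.inr ⟨l, rfl, h⟩))

theorem isLastZero_num (hz : IsGreatest {l | k l = 0} z) : IsLastZero k (num z) where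
  two_le := by simp [val_num]
  eq_zero _ hl := num_injective hl ▸ hz.1
  ne_zero _ hl h := (hz.2 h).not_gt (num_lt_num.1 hl)

namespace IsLastZero

theorem le (h : IsLastZero k i) (h' : IsLastZero k i') : i ≤ i' := by
  by_contra! hlt
  obtain ⟨l, rfl⟩ := exists_num_eq (h'.two_le.trans_lt hlt)
  exact h'.ne_zero l hlt (h.eq_zero l rfl)

theorem unique (h : IsLastZero k i) (h' : IsLastZero k i') : i = i' :=
  (h.le h').antisymm (h'.le h)

theorem lt_num_iff (h : IsLastZero k i) : i < num j ↔ AboveZeros k j := by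
  refine ⟨fun hj l hl => num_lt_num.1 ((not_lt.1 fun h' => h.ne_zero l h' hl).trans_lt hj),
    fun hj => ?_⟩
  by_contra! hle
  have hi : 3 ≤ i.val := (Nat.le_add_left 3 j).trans hle
  obtain ⟨l, rfl⟩ := exists_num_eq hi
  exact hle.not_gt (num_lt_num.2 (hj l (h.eq_zero l rfl)))

end IsLastZero

/-- The label that `π_lazy` gives to the new leaf when `j` wins the first round against `i`. -/
def kept (k : Fin n → ℕ) (i : Label n) (j : Fin n) : Label n := if 1 < k j then num j else i

/-- The label that `π_lazy` removes when `j` wins the first round against `i`. -/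
def dropped (k : Fin n → ℕ) (i : Label n) (j : Fin n) : Label n := if 1 < k j then i else num j

theorem kept_dropped_cases (k : Fin n → ℕ) (i : Label n) (j : Fin n) :
    1 < k j ∧ kept k i j = num j ∧ dropped k i j = i ∨
      ¬1 < k j ∧ kept k i j = i ∧ dropped k i j = num j := by
  unfold kept dropped
  split_ifs with h <;> simp [h]

end LastZero

namespace Filling

variable {n : ℕ} {P : Filling (n + 1)} {i : Label (n + 1)}

theorem height_rightmostEmpty_eq_zero (h : P.rightmostEmpty ≠ P 0) :
    P.height P.rightmostEmpty = 0 :=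
  height_eq_zero_iff.2 (Fin.cases h.symm P.ne_rightmostEmpty)

theorem dropped_eq_num_rightmostEmpty (hi : IsLastZero P.height i)
    (h0 : AboveZeros P.height (P 0)) :
    dropped P.height i (P 0) = num P.rightmostEmpty := by
  have hfirst := @update_height_eq_zero_iff n P (P 0)
  rw [Function.update_self] at hfirst
  rcases kept_dropped_cases P.height i (P 0) with ⟨hj, -, hd⟩ | ⟨hj, -, hd⟩
  · rw [hd]
    refine hi.unique (isLastZero_num ⟨height_rightmostEmpty_eq_zero fun hz => ?_,
      fun c hc => P.isGreatest_rightmostEmpty.2 fun m => height_eq_zero_iff.1 hc _⟩)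
    have := hfirst.2 (hz ▸ P.ne_rightmostEmpty)
    omega
  · rw [hd]
    exact congrArg num (le_antisymm (P.isGreatest_rightmostEmpty.2 (hfirst.1 (by omega)))
      (rightmostEmpty_le_of_aboveZeros h0))

theorem succAbove_le_of_isLastZero (hi : IsLastZero P.height i) (h0 : AboveZeros P.height (P 0))
    {a : Label n} (ha : IsLastZero P.r.height a) : (num P.rightmostEmpty).succAbove a ≤ i := by
  by_contra! hlt
  rcases lt_or_ge a.val 3 with ha3 | ha3
  · have hlow : a.castSucc < num P.rightmostEmpty := by
      rw [Fin.lt_def, Fin.val_castSucc, val_num]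
      omega
    rw [Fin.succAbove_of_castSucc_lt _ _ hlow, Fin.lt_def, Fin.val_castSucc] at hlt
    have := hi.two_le
    omega
  obtain ⟨l, rfl⟩ := exists_num_eq ha3
  rw [succAbove_num] at hlt
  have hempty : ∀ m : Fin n, P m.succ ≠ P.rightmostEmpty.succAbove l := fun m => by
    rw [← P.succAbove_r, Fin.succAbove_right_injective.ne_iff]
    exact height_eq_zero_iff.1 (ha.eq_zero l rfl) m
  by_cases hfirst : P 0 = P.rightmostEmpty.succAbove l
  · exact Fin.succAbove_ne _ _ ((P.isGreatest_rightmostEmpty.2 hempty).antisymm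
      (hfirst ▸ rightmostEmpty_le_of_aboveZeros h0))
  · exact hi.ne_zero _ hlt (height_eq_zero_iff.2 (Fin.cases hfirst hempty))

theorem succAbove_eq_of_isLastZero (hi : IsLastZero P.height i) (h0 : AboveZeros P.height (P 0))
    (hne : i ≠ num P.rightmostEmpty) {a : Label n} (ha : IsLastZero P.r.height a) :
    (num P.rightmostEmpty).succAbove a = i := by
  refine (succAbove_le_of_isLastZero hi h0 ha).antisymm ?_
  obtain ⟨y, rfl⟩ := Fin.exists_succAbove_eq hne
  rw [Fin.succAbove_le_succAbove_iff]
  by_contra! hlt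
  obtain ⟨l, rfl⟩ := exists_num_eq (ha.two_le.trans_lt hlt)
  refine ha.ne_zero l hlt (height_eq_zero_iff.2 fun m hm => ?_)
  refine height_eq_zero_iff.1 (hi.eq_zero _ (succAbove_num _ l).symm) m.succ ?_
  rw [← hm, P.succAbove_r]

end Filling

namespace TrivalentTree

variable {n : ℕ}

section Leaf

variable {T : TrivalentTree n}

theorem ncard_neighborSet_leaf (x : Label n) : (T.G.neighborSet (T.leaf x)).ncard = 1 :=
  (T.leaf_range _).1 ⟨x, rfl⟩

theorem exists_adj_leaf (x : Label n) : ∃ v, T.G.Adj v (T.leaf x) := by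
  obtain ⟨v, hv⟩ := Set.ncard_eq_one.1 (T.ncard_neighborSet_leaf x)
  exact ⟨v, SimpleGraph.Adj.symm (hv ▸ rfl : v ∈ T.G.neighborSet (T.leaf x))⟩

theorem eq_of_adj_leaf {x : Label n} {p q : T.V} (hp : T.G.Adj p (T.leaf x))
    (hq : T.G.Adj q (T.leaf x)) : p = q := by
  have := T.finite
  exact (Set.ncard_le_one (Set.toFinite _)).1 (T.ncard_neighborSet_leaf x).le p hp.symm q hq.symm

theorem not_adj_leaf_leaf (x y : Label n) : ¬ T.G.Adj (T.leaf x) (T.leaf y) := by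
  intro h
  obtain ⟨z, hz⟩ : ∃ z, z ∉ ({x, y} : Finset (Label n)) :=
    exists_label_notMem (Finset.card_le_two.trans_lt (by omega))
  have hmem : T.leaf z ∈ ({T.leaf x, T.leaf y} : Set T.V) := by
    refine mem_of_preconnected_of_adj_closed T.isTree.connected.preconnected (a := T.leaf x)
      (by simp) ?_ _
    rintro p (rfl | rfl) q hq
    · exact Or.inr (eq_of_adj_leaf hq.symm h.symm)
    · exact Or.inl (eq_of_adj_leaf hq.symm h)
  simp_all [T.leaf_injective.eq_iff]

theorem ne_leaf_of_adj {v : T.V} {x : Label n} (h : T.G.Adj v (T.leaf x)) (y : Label n) :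
    v ≠ T.leaf y := by
  rintro rfl
  exact not_adj_leaf_leaf _ _ h

theorem ncard_neighborSet_eq_three {v : T.V} (hv : ∀ x, v ≠ T.leaf x) :
    (T.G.neighborSet v).ncard = 3 :=
  (T.degree v).resolve_left fun h => by
    obtain ⟨x, hx⟩ := (T.leaf_range v).2 h
    exact hv x hx.symm

end Leaf

/-- The vertex `v` is adjacent to the leaves `i` and `j`, and its third neighbour is `w`. -/
structure IsCherry (T : TrivalentTree n) (v w : T.V) (i j : Label n) : Prop where
  ne : i ≠ j
  third_ne_left : w ≠ T.leaf i
  third_ne_right : w ≠ T.leaf j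
  neighborSet_eq : T.G.neighborSet v = {T.leaf i, T.leaf j, w}

theorem exists_isCherry {T : TrivalentTree n} {v : T.V} {i j : Label n} (hij : i ≠ j)
    (hi : T.G.Adj v (T.leaf i)) (hj : T.G.Adj v (T.leaf j)) : ∃ w, T.IsCherry v w i j := by
  obtain ⟨w, hwi, hwj, hw⟩ := exists_eq_triple_of_ncard_eq_three
    (ncard_neighborSet_eq_three (ne_leaf_of_adj hi)) hi hj (T.leaf_injective.ne hij)
  exact ⟨w, hij, hwi, hwj, hw⟩

namespace IsCherry

variable {T : TrivalentTree n} {v w : T.V} {i j : Label n}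

theorem adj_iff (h : T.IsCherry v w i j) {t : T.V} :
    T.G.Adj v t ↔ t = T.leaf i ∨ t = T.leaf j ∨ t = w := by
  rw [← SimpleGraph.mem_neighborSet, h.neighborSet_eq]
  rfl

theorem adj_left (h : T.IsCherry v w i j) : T.G.Adj v (T.leaf i) := h.adj_iff.2 (by simp)

theorem adj_right (h : T.IsCherry v w i j) : T.G.Adj v (T.leaf j) := h.adj_iff.2 (by simp)

theorem adj_third (h : T.IsCherry v w i j) : T.G.Adj v w := h.adj_iff.2 (by simp)

theorem symm (h : T.IsCherry v w i j) : T.IsCherry v w j i :=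
  ⟨h.ne.symm, h.third_ne_right, h.third_ne_left, h.neighborSet_eq.trans (Set.insert_comm _ _ _)⟩

theorem ne_leaf (h : T.IsCherry v w i j) (y : Label n) : v ≠ T.leaf y :=
  ne_leaf_of_adj h.adj_left y

theorem third_ne_leaf {T : TrivalentTree (n + 1)} {v w : T.V} {i j : Label (n + 1)}
    (h : T.IsCherry v w i j) (z : Label (n + 1)) : w ≠ T.leaf z := by
  rintro rfl
  obtain ⟨u, hu⟩ : ∃ u, u ∉ ({i, j, z} : Finset (Label (n + 1))) :=
    exists_label_notMem (Finset.card_le_three.trans_lt (by omega))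
  have hmem : T.leaf u ∈ ({v, T.leaf i, T.leaf j, T.leaf z} : Set T.V) := by
    refine mem_of_preconnected_of_adj_closed T.isTree.connected.preconnected (a := v) (by simp) ?_ _
    rintro p (rfl | rfl | rfl | rfl) q hq
    · exact Or.inr (h.adj_iff.1 hq)
    · exact Or.inl (eq_of_adj_leaf hq.symm h.adj_left)
    · exact Or.inl (eq_of_adj_leaf hq.symm h.adj_right)
    · exact Or.inl (eq_of_adj_leaf hq.symm h.adj_third)
  simp_all [T.leaf_injective.eq_iff, (h.ne_leaf u).symm]

theorem mem_incidenceSet_iff (h : T.IsCherry v w i j) {e : Sym2 T.V} :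
    e ∈ T.G.incidenceSet v ↔ e = s(v, T.leaf i) ∨ e = s(v, T.leaf j) ∨ e = s(v, w) := by
  constructor
  · rintro ⟨he, t, rfl⟩
    rcases h.adj_iff.1 he with rfl | rfl | rfl <;> simp
  · rintro (rfl | rfl | rfl)
    exacts [⟨h.adj_left, by simp⟩, ⟨h.adj_right, by simp⟩, ⟨h.adj_third, by simp⟩]

theorem eq_or_eq_of_adj_leaf {T : TrivalentTree (n + 1)} {v w : T.V} {i j x : Label (n + 1)}
    (h : T.IsCherry v w i j) (hx : T.G.Adj v (T.leaf x)) : x = i ∨ x = j := by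
  rcases h.adj_iff.1 hx with h' | h' | h'
  · exact Or.inl (T.leaf_injective h')
  · exact Or.inr (T.leaf_injective h')
  · exact absurd h'.symm (h.third_ne_leaf x)

end IsCherry

section Initial

variable {T : TrivalentTree n}

open Classical in
/-- The labelling at the start of the tournament, the only one that satisfies `IsInitial`. -/
noncomputable def initial (T : TrivalentTree n) : T.EdgeLabeling :=
  fun e => if h : ∃ x, e ∈ T.G.edgeSet ∧ T.leaf x ∈ e then some h.choose else none

theorem isInitial_initial : T.IsInitial T.initial := by
  intro e x
  by_cases h : ∃ x, e ∈ T.G.edgeSet ∧ T.leaf x ∈ e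
  · simp only [initial, h, ↓reduceDIte, Option.some.injEq]
    refine ⟨fun hx => hx ▸ h.choose_spec, fun ⟨he, hx⟩ => ?_⟩
    by_contra hne
    rw [(Sym2.mem_and_mem_iff (T.leaf_injective.ne hne)).1 ⟨h.choose_spec.2, hx⟩] at he
    exact not_adj_leaf_leaf _ _ he
  · simp only [initial, h, ↓reduceDIte, reduceCtorEq, false_iff]
    exact fun h' => h ⟨x, h'⟩

theorem initial_eq_some_iff {e : Sym2 T.V} {x : Label n} :
    T.initial e = some x ↔ e ∈ T.G.edgeSet ∧ T.leaf x ∈ e :=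
  isInitial_initial e x

theorem isInitial_iff {lab : T.EdgeLabeling} : T.IsInitial lab ↔ lab = T.initial :=
  ⟨fun h => funext fun e => Option.ext fun x => (h e x).trans (isInitial_initial e x).symm,
    fun h => h ▸ isInitial_initial⟩

theorem isTournament_iff_run {rs : List (Label n × Label n)} :
    T.IsTournament rs ↔ T.Run T.initial rs := by
  simp only [IsTournament, isInitial_iff, exists_eq_left]

theorem initial_leaf_edge {v : T.V} {x : Label n} (hv : T.G.Adj v (T.leaf x)) :
    T.initial s(v, T.leaf x) = some x :=
  initial_eq_some_iff.2 ⟨hv, by simp⟩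

theorem initial_eq_none {v w : T.V} (hv : ∀ x, v ≠ T.leaf x) (hw : ∀ x, w ≠ T.leaf x) :
    T.initial s(v, w) = none := by
  refine Option.eq_none_iff_forall_ne_some.2 fun x hx => ?_
  rcases Sym2.mem_iff.1 (initial_eq_some_iff.1 hx).2 with h | h
  exacts [hv x h.symm, hw x h.symm]

theorem eq_leaf_edge_of_initial_eq_some {v : T.V} {e : Sym2 T.V} {x : Label n}
    (hv : ∀ x, v ≠ T.leaf x) (he : v ∈ e) (hx : T.initial e = some x) :
    e = s(v, T.leaf x) ∧ T.G.Adj v (T.leaf x) := by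
  obtain ⟨hedge, hxe⟩ := initial_eq_some_iff.1 hx
  obtain rfl := (Sym2.mem_and_mem_iff (hv x)).1 ⟨he, hxe⟩
  exact ⟨rfl, hedge⟩

theorem ne_leaf_of_incidenceSet_nontrivial {v : T.V} (h : (T.G.incidenceSet v).Nontrivial)
    (x : Label n) : v ≠ T.leaf x := by
  rintro rfl
  obtain ⟨_, ⟨he, p, rfl⟩, _, ⟨hf, q, rfl⟩, hef⟩ := h
  exact hef (congrArg _ (eq_of_adj_leaf (SimpleGraph.Adj.symm he) (SimpleGraph.Adj.symm hf)))

theorem canFaceOff_initial_iff {T : TrivalentTree (n + 1)} {i j : Label (n + 1)} {E : Sym2 T.V} :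
    T.CanFaceOff T.initial i j E ↔ i < j ∧ ∃ v w, T.IsCherry v w i j ∧ E = s(v, w) := by
  constructor
  · rintro ⟨hij, v, e, he, f, hf, hef, hE, hei, hfj, hE0⟩
    have hv := ne_leaf_of_incidenceSet_nontrivial ⟨e, he, f, hf, hef⟩
    obtain ⟨rfl, hi⟩ := eq_leaf_edge_of_initial_eq_some hv he.2 hei
    obtain ⟨rfl, hj⟩ := eq_leaf_edge_of_initial_eq_some hv hf.2 hfj
    obtain ⟨w, hw⟩ := exists_isCherry hij.ne hi hj
    refine ⟨hij, v, w, hw, ?_⟩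
    rcases hw.mem_incidenceSet_iff.1 hE with rfl | rfl | rfl
    · simp [hei] at hE0
    · simp [hfj] at hE0
    · rfl
  · rintro ⟨hij, v, w, hw, rfl⟩
    exact ⟨hij, v, _, ⟨hw.adj_left, by simp⟩, _, ⟨hw.adj_right, by simp⟩,
      fun he => hij.ne (T.leaf_injective (Sym2.congr_right.1 he)), ⟨hw.adj_third, by simp⟩,
      initial_leaf_edge hw.adj_left, initial_leaf_edge hw.adj_right,
      initial_eq_none hw.ne_leaf hw.third_ne_leaf⟩

theorem lazinessApplies_initial_iff {T : TrivalentTree (n + 1)} {v w : T.V}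
    {i j : Label (n + 1)} (hc : T.IsCherry v w i j) :
    T.LazinessApplies T.initial i j s(v, w) ↔ ∃ u, T.G.Adj w (T.leaf u) ∧ u ≠ j ∧ i < u := by
  constructor
  · rintro ⟨g, -, hgE, ⟨p, hp, hpg⟩, u, hu, huj, hiu⟩
    rcases Sym2.mem_iff.1 hp with rfl | rfl
    · have hadj := (eq_leaf_edge_of_initial_eq_some hc.ne_leaf hpg hu).2
      exact absurd (hc.eq_or_eq_of_adj_leaf hadj) (by simp [hiu.ne', huj])
    · exact ⟨u, (eq_leaf_edge_of_initial_eq_some hc.third_ne_leaf hpg hu).2, huj, hiu⟩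
  · rintro ⟨u, hu, huj, hiu⟩
    refine ⟨s(w, T.leaf u), hu, fun he => ?_, ⟨w, by simp, by simp⟩, u, initial_leaf_edge hu, huj,
      hiu⟩
    rw [Sym2.eq_swap, Sym2.congr_left] at he
    exact hc.ne_leaf u he.symm

end Initial

section Counting

theorem card_vertices (T : TrivalentTree n) : Nat.card T.V + 2 = 2 * (n + 3) := by
  classical
  have := T.finite
  have := Fintype.ofFinite T.V
  have hdegree : ∀ v, T.G.degree v + 2 * (if v ∈ Finset.univ.image T.leaf then 1 else 0) = 3 := by
    intro v
    rw [← SimpleGraph.card_neighborSet_eq_degree, ← Set.toFinset_card,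
      ← Set.ncard_eq_toFinset_card']
    have hleaf : v ∈ Finset.univ.image T.leaf ↔ (T.G.neighborSet v).ncard = 1 := by
      simp [← T.leaf_range]
    rcases T.degree v with h | h <;> simp [hleaf, h]
  have hleaves : ∑ v, (if v ∈ Finset.univ.image T.leaf then 1 else 0) = n + 3 := by
    simp [Finset.card_image_of_injective _ T.leaf_injective]
  have hsum : ∑ v, T.G.degree v + 2 * (n + 3) = 3 * Fintype.card T.V := by
    rw [← hleaves, Finset.mul_sum, ← Finset.sum_add_distrib,
      Finset.sum_congr rfl fun v _ => hdegree v, Finset.sum_const, smul_eq_mul,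
      mul_comm, Finset.card_univ]
  have hedges := T.isTree.card_edgeFinset
  rw [T.G.sum_degrees_eq_twice_card_edges] at hsum
  rw [Nat.card_eq_fintype_card]
  omega

theorem ncard_internal (T : TrivalentTree n) : {v | ∀ x, v ≠ T.leaf x}.ncard = n + 1 := by
  have := T.finite
  have hcompl : {v | ∀ x, v ≠ T.leaf x} = (Set.range T.leaf)ᶜ := by
    ext v
    simp [eq_comm]
  have hadd := Set.ncard_add_ncard_compl (Set.range T.leaf)
  have hcard := T.card_vertices
  rw [Set.ncard_range_of_injective T.leaf_injective, Nat.card_fin, ← hcompl] at hadd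
  omega

/-- There are `n + 2` leaves other than `a` and `b`, but only `n + 1` internal vertices away from
`a` and `b` for them to be attached to. -/
theorem exists_isCherry_two_le {T : TrivalentTree (n + 1)} (hT : T.ABShareVertex) :
    ∃ v w i j, 2 ≤ i.val ∧ i < j ∧ T.IsCherry v w i j := by
  have := T.finite
  obtain ⟨o, ha, hb⟩ := hT
  obtain ⟨o', ho⟩ := exists_isCherry (by simp) ha hb
  choose nb hnb using T.exists_adj_leaf
  let c : Label (n + 1) := ⟨2, by omega⟩
  have hcard : ({v | ∀ x, v ≠ T.leaf x} \ {o}).ncard < (Set.Ici c).ncard := by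
    rw [Set.ncard_sdiff_singleton_of_mem (s := {v | ∀ x, v ≠ T.leaf x}) ho.ne_leaf,
      ncard_internal, ← Finset.coe_Ici, Set.ncard_coe_finset, Fin.card_Ici]
    simp only [c]
    omega
  have hmaps : ∀ x ∈ Set.Ici c, nb x ∈ {v | ∀ x, v ≠ T.leaf x} \ {o} := by
    refine fun x hx => ⟨fun y => ne_leaf_of_adj (hnb x) y, fun hxo : nb x = o => ?_⟩
    rcases ho.adj_iff.1 (hxo ▸ hnb x) with h | h | h
    · simp [T.leaf_injective h, c] at hx
    · simp [T.leaf_injective h, c, Fin.le_def] at hx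
    · exact ho.third_ne_leaf x h.symm
  obtain ⟨x, hx, y, hy, hxy, he⟩ := Set.exists_ne_map_eq_of_ncard_lt_of_maps_to hcard hmaps
  obtain ⟨w, hw⟩ := exists_isCherry hxy (hnb x) (he ▸ hnb y)
  rcases lt_or_gt_of_ne hxy with h | h
  · exact ⟨_, w, x, y, hx, h, hw⟩
  · exact ⟨_, w, y, x, hy, h, hw.symm⟩

end Counting

section Advance

variable {T : TrivalentTree n} {lab : T.EdgeLabeling} {E F : Sym2 T.V} {x y i j : Label n}

open scoped Classical in
theorem advance_eq_update : T.advance lab i j E =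
    Function.update lab E (some (if T.LazinessApplies lab i j E then i else j)) := by
  funext e
  simp only [advance, Function.update_apply]

theorem CanFaceOff.mem_edgeSet (h : T.CanFaceOff lab i j E) : E ∈ T.G.edgeSet := by
  obtain ⟨-, v, e, -, f, -, -, hE, -⟩ := h
  exact hE.1

theorem CanFaceOff.eq_none (h : T.CanFaceOff lab i j E) : lab E = none := by
  obtain ⟨-, v, e, -, f, -, -, -, -, -, h0⟩ := h
  exact h0

open scoped Classical in
theorem FacesOff.le_of_canFaceOff_advance (h : T.FacesOff lab i j E) {i' j' : Label n}
    {E' : Sym2 T.V} (h' : T.CanFaceOff (T.advance lab i j E) i' j' E') : i' ≤ i := by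
  obtain ⟨hij, v, e, he, f, hf, hef, hE, hei, hfj, hE0⟩ := h'
  rw [advance_eq_update] at hei hfj hE0
  set z := if T.LazinessApplies lab i j E then i else j with hz
  by_contra! hi
  -- A label above `i` advances to `E` only if it is the only label above `i` next to `E`.
  have hunique : v ∈ E → i < z → ∀ g ∈ T.G.incidenceSet v, g ≠ E → ∀ u, lab g = some u →
      i < u → u = z := by
    intro hv hiz g hg hgE u hu hiu
    have hlazy : ¬ T.LazinessApplies lab i j E := fun hl => hiz.ne (by rw [hz, if_pos hl])
    rw [hz, if_neg hlazy]
    by_contra huj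
    exact hlazy ⟨g, hg.1, hgE, ⟨v, hv, hg.2⟩, u, hu, huj, hiu⟩
  by_cases heE : e = E
  · subst heE
    rw [Function.update_self, Option.some.injEq] at hei
    rw [Function.update_of_ne hef.symm] at hfj
    exact hij.ne' ((hunique he.2 (hei ▸ hi) f hf hef.symm j' hfj (hi.trans hij)).trans hei)
  rw [Function.update_of_ne heE] at hei
  by_cases hfE : f = E
  · subst hfE
    rw [Function.update_self, Option.some.injEq] at hfj
    exact hij.ne ((hunique hf.2 (hfj ▸ hi.trans hij) e he hef i' hei hi).trans hfj)
  rw [Function.update_of_ne hfE] at hfj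
  exact hi.not_ge (h.2 i' j' E' ⟨hij, v, e, he, f, hf, hef, hE, hei, hfj,
    (ne_and_eq_none_of_update_eq_none hE0).2⟩)

/-- The label `j` on the edge `E` takes no part in the remaining rounds, provided that it does not
win one, and the same holds if it is replaced by the smaller label `i`: all losers to come are below
`i`, and the other edges with label `i` or `j` have no unlabelled edge next to them. -/
structure IsIdle (T : TrivalentTree n) (lab : T.EdgeLabeling) (E : Sym2 T.V) (i j : Label n) :
    Prop where
  lt : i < j
  label_eq : lab E = some j
  loser_lt : ∀ x y F, T.CanFaceOff lab x y F → x < i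
  adjacent_ne_none : ∀ g ∈ T.G.edgeSet, g ≠ E → lab g = some i ∨ lab g = some j →
    ∀ F ∈ T.G.edgeSet, (∃ v, v ∈ g ∧ v ∈ F) → lab F ≠ none

namespace IsIdle

theorem ne_of_canFaceOff (h : T.IsIdle lab E i j) (hc : T.CanFaceOff lab x y F) : E ≠ F := by
  rintro rfl
  simpa [h.label_eq] using hc.eq_none

theorem winner_ne (h : T.IsIdle lab E i j) (hc : T.CanFaceOff lab x y F) : y ≠ i := by
  rintro rfl
  obtain ⟨-, v, -, -, f, hf, -, hF, -, hfy, hF0⟩ := hc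
  refine h.adjacent_ne_none f hf.1 ?_ (Or.inl hfy) F hF.1 ⟨v, hf.2, hF.2⟩ hF0
  rintro rfl
  exact h.lt.ne' (Option.some.inj (h.label_eq.symm.trans hfy))

open scoped Classical in
theorem canFaceOff_update (h : T.IsIdle lab E i j) (hc : T.CanFaceOff lab x y F) (hy : y ≠ j) :
    T.CanFaceOff (Function.update lab E (some i)) x y F := by
  have hx := (h.loser_lt x y F hc).trans h.lt
  have hF := (h.ne_of_canFaceOff hc).symm
  obtain ⟨hxy, v, e, he, f, hf, hef, hFv, hex, hfy, hF0⟩ := hc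
  have hne : ∀ {g z}, lab g = some z → z ≠ j → g ≠ E := fun hg hz hgE =>
    hz (Option.some.inj (hg.symm.trans (hgE ▸ h.label_eq)))
  refine ⟨hxy, v, e, he, f, hf, hef, hFv, ?_, ?_, ?_⟩
  · rwa [Function.update_of_ne (hne hex hx.ne)]
  · rwa [Function.update_of_ne (hne hfy hy)]
  · rwa [Function.update_of_ne hF]

open scoped Classical in
theorem exists_canFaceOff_of_update (h : T.IsIdle lab E i j)
    (hc : T.CanFaceOff (Function.update lab E (some i)) x y F) : ∃ y', T.CanFaceOff lab x y' F := by
  obtain ⟨hxy, v, e, he, f, hf, hef, hF, hex, hfy, hF0⟩ := hc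
  replace hF0 := (ne_and_eq_none_of_update_eq_none hF0).2
  by_cases heE : e = E
  · subst heE
    rw [Function.update_self, Option.some.injEq] at hex
    subst hex
    rw [Function.update_of_ne hef.symm] at hfy
    rcases lt_trichotomy j y with hj | rfl | hj
    · exact absurd (h.loser_lt _ _ _ ⟨hj, v, e, he, f, hf, hef, hF, h.label_eq, hfy, hF0⟩)
        h.lt.not_gt
    · exact absurd hF0 (h.adjacent_ne_none f hf.1 hef.symm (Or.inr hfy) F hF.1 ⟨v, hf.2, hF.2⟩)
    · exact absurd (h.loser_lt _ _ _ ⟨hj, v, f, hf, e, he, hef.symm, hF, hfy, h.label_eq, hF0⟩)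
        hxy.not_gt
  rw [Function.update_of_ne heE] at hex
  by_cases hfE : f = E
  · subst hfE
    rw [Function.update_self, Option.some.injEq] at hfy
    subst hfy
    exact ⟨j, hxy.trans h.lt, v, e, he, f, hf, hef, hF, hex, h.label_eq, hF0⟩
  · rw [Function.update_of_ne hfE] at hfy
    exact ⟨y, hxy, v, e, he, f, hf, hef, hF, hex, hfy, hF0⟩

open scoped Classical in
theorem facesOff_update (h : T.IsIdle lab E i j) (hf : T.FacesOff lab x y F) (hy : y ≠ j) :
    T.FacesOff (Function.update lab E (some i)) x y F :=
  ⟨h.canFaceOff_update hf.1 hy, fun _ _ _ hc => by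
    obtain ⟨_, hc⟩ := h.exists_canFaceOff_of_update hc
    exact hf.2 _ _ _ hc⟩

open scoped Classical in
theorem lazinessApplies_update_iff (h : T.IsIdle lab E i j) (hc : T.CanFaceOff lab x y F)
    (hy : y ≠ j) :
    T.LazinessApplies (Function.update lab E (some i)) x y F ↔ T.LazinessApplies lab x y F := by
  have hxi := h.loser_lt x y F hc
  refine exists_congr fun g => and_congr_right fun _ => and_congr_right fun _ =>
    and_congr_right fun _ => ?_
  by_cases hgE : g = E
  · subst hgE
    simp only [Function.update_self, h.label_eq, Option.some.injEq, exists_eq_left']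
    exact iff_of_true ⟨(h.winner_ne hc).symm, hxi⟩ ⟨hy.symm, hxi.trans h.lt⟩
  · rw [Function.update_of_ne hgE]

open scoped Classical in
theorem advance (h : T.IsIdle lab E i j) (hf : T.FacesOff lab x y F) (hy : y ≠ j) :
    T.IsIdle (T.advance lab x y F) E i j where
  lt := h.lt
  label_eq := by rw [advance_eq_update, Function.update_of_ne (h.ne_of_canFaceOff hf.1), h.label_eq]
  loser_lt _ _ _ hc := (hf.le_of_canFaceOff_advance hc).trans_lt (h.loser_lt _ _ _ hf.1)
  adjacent_ne_none g hg hgE hgl F' hF' hv hF'0 := by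
    have hxi := h.loser_lt x y F hf.1
    rw [advance_eq_update] at hgl hF'0
    refine h.adjacent_ne_none g hg hgE ?_ F' hF' hv (ne_and_eq_none_of_update_eq_none hF'0).2
    rwa [Function.update_of_ne] at hgl
    rintro rfl
    rw [Function.update_self, Option.some.injEq, Option.some.injEq] at hgl
    split_ifs at hgl
    · exact hgl.elim hxi.ne (hxi.trans h.lt).ne
    · exact hgl.elim (h.winner_ne hf.1) hy

end IsIdle

open scoped Classical in
theorem Run.update {rs : List (Label n × Label n)} (h : T.Run lab rs) (hidle : T.IsIdle lab E i j)
    (hrs : ∀ p ∈ rs, p.2 ≠ j) : T.Run (Function.update lab E (some i)) rs := by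
  induction h with
  | done lab h =>
    exact Run.done _ fun e he h0 => h e he (ne_and_eq_none_of_update_eq_none h0).2
  | round lab x y F rs hf _ ih =>
    have hy : y ≠ j := hrs (x, y) (by simp)
    have hadvance : T.advance (Function.update lab E (some i)) x y F =
        Function.update (T.advance lab x y F) E (some i) := by
      simp only [advance_eq_update, hidle.lazinessApplies_update_iff hf.1 hy]
      rw [Function.update_comm (hidle.ne_of_canFaceOff hf.1)]
    refine Run.round _ x y F rs (hidle.facesOff_update hf hy) ?_
    rw [hadvance]
    exact ih (hidle.advance hf hy) fun p hp => hrs p (List.mem_cons_of_mem _ hp)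

end Advance

/-- `φ` embeds `B` in `A` as what is left when the leaves `keep` and `drop` next to `v` are
removed, and `v` gets the label `keep`. -/
structure PrunesTo (A : TrivalentTree (n + 1)) (v w : A.V) (keep drop : Label (n + 1))
    (B : TrivalentTree n) (φ : B.G ↪g A.G) : Prop where
  cherry : A.IsCherry v w keep drop
  range_eq : Set.range φ = {w | w ≠ A.leaf keep ∧ w ≠ A.leaf drop}
  map_leaf : ∀ y, φ (B.leaf y) =
    if drop.succAbove y = keep then v else A.leaf (drop.succAbove y)

namespace PrunesTo

variable {A : TrivalentTree (n + 1)} {v w : A.V} {keep drop : Label (n + 1)}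
  {B : TrivalentTree n} {φ : B.G ↪g A.G}

theorem ne_keep (h : A.PrunesTo v w keep drop B φ) (u : B.V) : φ u ≠ A.leaf keep :=
  (h.range_eq ▸ Set.mem_range_self u : φ u ∈ {w | w ≠ A.leaf keep ∧ w ≠ A.leaf drop}).1

theorem ne_drop (h : A.PrunesTo v w keep drop B φ) (u : B.V) : φ u ≠ A.leaf drop :=
  (h.range_eq ▸ Set.mem_range_self u : φ u ∈ {w | w ≠ A.leaf keep ∧ w ≠ A.leaf drop}).2

theorem exists_map_eq (h : A.PrunesTo v w keep drop B φ) {u : A.V} (hk : u ≠ A.leaf keep)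
    (hd : u ≠ A.leaf drop) : ∃ u', φ u' = u := by
  rw [← Set.mem_range, h.range_eq]
  exact ⟨hk, hd⟩

theorem exists_succAbove_eq (h : A.PrunesTo v w keep drop B φ) :
    ∃ y, drop.succAbove y = keep ∧ φ (B.leaf y) = v := by
  obtain ⟨y, hy⟩ := Fin.exists_succAbove_eq h.cherry.ne
  exact ⟨y, hy, by rw [h.map_leaf, if_pos hy]⟩

theorem map_leaf_of_ne (h : A.PrunesTo v w keep drop B φ) {y : Label n}
    (hy : drop.succAbove y ≠ keep) : φ (B.leaf y) = A.leaf (drop.succAbove y) := by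
  rw [h.map_leaf, if_neg hy]

theorem exists_adj_map_eq (h : A.PrunesTo v w keep drop B φ) {u : B.V} (hu : φ u ≠ v) {t : A.V}
    (ht : A.G.Adj (φ u) t) : ∃ t', B.G.Adj u t' ∧ φ t' = t := by
  obtain ⟨t', rfl⟩ := h.exists_map_eq (u := t)
    (fun h' => hu (eq_of_adj_leaf (h' ▸ ht) h.cherry.adj_left))
    (fun h' => hu (eq_of_adj_leaf (h' ▸ ht) h.cherry.adj_right))
  exact ⟨t', φ.map_adj_iff.1 ht, rfl⟩

theorem exists_incidenceSet_map_eq (h : A.PrunesTo v w keep drop B φ) {u : B.V} (hu : φ u ≠ v)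
    {e : Sym2 A.V} (he : e ∈ A.G.incidenceSet (φ u)) :
    ∃ e' ∈ B.G.incidenceSet u, e'.map φ = e := by
  obtain ⟨he, t, rfl⟩ := he
  obtain ⟨t', ht', rfl⟩ := h.exists_adj_map_eq hu he
  exact ⟨s(u, t'), ⟨ht', by simp⟩, by simp⟩

theorem map_mem_map_iff {u : B.V} {e : Sym2 B.V} : φ u ∈ e.map φ ↔ u ∈ e := by
  simp [Sym2.mem_map, φ.injective.eq_iff]

/-- `lab'` is the restriction of the labelling `lab` of `A` to `B`, up to the renumbering of the
labels, and `lab` leaves no edge at `v` unlabelled. -/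
structure Restricts (h : A.PrunesTo v w keep drop B φ) (lab : A.EdgeLabeling)
    (lab' : B.EdgeLabeling) : Prop where
  map_eq : ∀ e, lab (e.map φ) = (lab' e).map drop.succAbove
  ne_none : ∀ e ∈ A.G.incidenceSet v, lab e ≠ none

namespace Restricts

variable {h : A.PrunesTo v w keep drop B φ} {lab : A.EdgeLabeling} {lab' : B.EdgeLabeling}

theorem exists_map_eq (hr : h.Restricts lab lab') {u : A.V} {E : Sym2 A.V}
    (hE : E ∈ A.G.incidenceSet u) (h0 : lab E = none) : ∃ u', φ u' = u ∧ φ u' ≠ v := by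
  have huv : u ≠ v := by
    rintro rfl
    exact hr.ne_none E hE h0
  have hleaf : ∀ x, A.G.Adj v (A.leaf x) → u ≠ A.leaf x := by
    rintro x hx rfl
    obtain ⟨hE, t, rfl⟩ := hE
    obtain rfl : t = v := eq_of_adj_leaf (SimpleGraph.Adj.symm hE) hx
    exact hr.ne_none _ ⟨hE, by simp⟩ h0
  obtain ⟨u', rfl⟩ := h.exists_map_eq (hleaf _ h.cherry.adj_left) (hleaf _ h.cherry.adj_right)
  exact ⟨u', rfl, huv⟩

theorem eq_none_iff (hr : h.Restricts lab lab') {e : Sym2 B.V} :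
    lab (e.map φ) = none ↔ lab' e = none := by
  rw [hr.map_eq, Option.map_eq_none_iff]

theorem eq_some_iff (hr : h.Restricts lab lab') {e : Sym2 B.V} {x : Label n} :
    lab (e.map φ) = some (drop.succAbove x) ↔ lab' e = some x := by
  rw [hr.map_eq, Option.map_eq_some_iff]
  exact ⟨fun ⟨_, ha, hx⟩ => Fin.succAbove_right_injective hx ▸ ha, fun hx => ⟨x, hx, rfl⟩⟩

theorem exists_eq_some (hr : h.Restricts lab lab') {e : Sym2 B.V} {x : Label (n + 1)}
    (hx : lab (e.map φ) = some x) : ∃ x', drop.succAbove x' = x ∧ lab' e = some x' := by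
  rw [hr.map_eq, Option.map_eq_some_iff] at hx
  obtain ⟨x', he, hx⟩ := hx
  exact ⟨x', hx, he⟩

theorem canFaceOff (hr : h.Restricts lab lab') {x y : Label n} {E : Sym2 B.V}
    (hc : B.CanFaceOff lab' x y E) :
    A.CanFaceOff lab (drop.succAbove x) (drop.succAbove y) (E.map φ) := by
  obtain ⟨hxy, u, e, he, f, hf, hef, hE, hex, hfy, hE0⟩ := hc
  exact ⟨Fin.succAbove_lt_succAbove_iff.2 hxy, φ u, _, map_mem_incidenceSet_of_embedding φ he, _,
    map_mem_incidenceSet_of_embedding φ hf, (Sym2.map.injective φ.injective).ne hef,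
    map_mem_incidenceSet_of_embedding φ hE, hr.eq_some_iff.2 hex, hr.eq_some_iff.2 hfy,
    hr.eq_none_iff.2 hE0⟩

theorem exists_canFaceOff (hr : h.Restricts lab lab') {x y : Label (n + 1)} {E : Sym2 A.V}
    (hc : A.CanFaceOff lab x y E) : ∃ x' y' E', drop.succAbove x' = x ∧ drop.succAbove y' = y ∧
      E'.map φ = E ∧ B.CanFaceOff lab' x' y' E' := by
  obtain ⟨hxy, u, e, he, f, hf, hef, hE, hex, hfy, hE0⟩ := hc
  obtain ⟨u, rfl, hu⟩ := hr.exists_map_eq hE hE0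
  obtain ⟨e, he', rfl⟩ := h.exists_incidenceSet_map_eq hu he
  obtain ⟨f, hf', rfl⟩ := h.exists_incidenceSet_map_eq hu hf
  obtain ⟨E, hE', rfl⟩ := h.exists_incidenceSet_map_eq hu hE
  obtain ⟨x, rfl, hex'⟩ := hr.exists_eq_some hex
  obtain ⟨y, rfl, hfy'⟩ := hr.exists_eq_some hfy
  exact ⟨x, y, E, rfl, rfl, rfl, Fin.succAbove_lt_succAbove_iff.1 hxy, u, e, he', f, hf',
    fun h' => hef (h' ▸ rfl), hE', hex', hfy', hr.eq_none_iff.1 hE0⟩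

theorem facesOff_iff (hr : h.Restricts lab lab') {x y : Label n} {E : Sym2 B.V} :
    A.FacesOff lab (drop.succAbove x) (drop.succAbove y) (E.map φ) ↔ B.FacesOff lab' x y E := by
  constructor
  · rintro ⟨hc, hmax⟩
    obtain ⟨x', y', E', hx, hy, hE, hc'⟩ := hr.exists_canFaceOff hc
    obtain rfl := Fin.succAbove_right_injective hx
    obtain rfl := Fin.succAbove_right_injective hy
    obtain rfl := Sym2.map.injective φ.injective hE
    exact ⟨hc', fun _ _ _ h' =>
      Fin.succAbove_le_succAbove_iff.1 (hmax _ _ _ (hr.canFaceOff h'))⟩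
  · rintro ⟨hc, hmax⟩
    refine ⟨hr.canFaceOff hc, fun _ _ _ h' => ?_⟩
    obtain ⟨x', y', E', rfl, rfl, rfl, hc'⟩ := hr.exists_canFaceOff h'
    exact Fin.succAbove_le_succAbove_iff.2 (hmax _ _ _ hc')

theorem lazinessApplies_iff (hr : h.Restricts lab lab') {x y : Label n} {E : Sym2 B.V}
    (hE : E ∈ B.G.edgeSet) (h0 : lab' E = none) :
    A.LazinessApplies lab (drop.succAbove x) (drop.succAbove y) (E.map φ) ↔
      B.LazinessApplies lab' x y E := by
  constructor
  · rintro ⟨g, hg, hgE, ⟨p, hp, hpg⟩, u, hu, huy, hxu⟩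
    obtain ⟨p, rfl, hpv⟩ :=
      hr.exists_map_eq ⟨φ.map_mem_edgeSet_iff.2 hE, hp⟩ (hr.eq_none_iff.2 h0)
    obtain ⟨g, hg', rfl⟩ := h.exists_incidenceSet_map_eq hpv ⟨hg, hpg⟩
    obtain ⟨u, rfl, hu'⟩ := hr.exists_eq_some hu
    exact ⟨g, hg'.1, fun h' => hgE (h' ▸ rfl), ⟨p, map_mem_map_iff.1 hp, hg'.2⟩, u, hu',
      fun h' => huy (h' ▸ rfl), Fin.succAbove_lt_succAbove_iff.1 hxu⟩
  · rintro ⟨g, hg, hgE, ⟨p, hp, hpg⟩, u, hu, huy, hxu⟩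
    exact ⟨g.map φ, φ.map_mem_edgeSet_iff.2 hg, (Sym2.map.injective φ.injective).ne hgE,
      ⟨φ p, map_mem_map_iff.2 hp, map_mem_map_iff.2 hpg⟩, _, hr.eq_some_iff.2 hu,
      Fin.succAbove_right_injective.ne huy, Fin.succAbove_lt_succAbove_iff.2 hxu⟩

open scoped Classical in
theorem advance (hr : h.Restricts lab lab') {x y : Label n} {E : Sym2 B.V}
    (hE : E ∈ B.G.edgeSet) (h0 : lab' E = none) :
    h.Restricts (A.advance lab (drop.succAbove x) (drop.succAbove y) (E.map φ))
      (B.advance lab' x y E) := by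
  have hiff := hr.lazinessApplies_iff (x := x) (y := y) hE h0
  rw [advance_eq_update, advance_eq_update]
  refine ⟨fun e => ?_, fun e he h' => hr.ne_none e he (ne_and_eq_none_of_update_eq_none h').2⟩
  by_cases he : e = E
  · simp only [he, Function.update_self, Option.map_some, apply_ite drop.succAbove, hiff]
  · rw [Function.update_of_ne he, Function.update_of_ne ((Sym2.map.injective φ.injective).ne he),
      hr.map_eq]

theorem run (hr : h.Restricts lab lab') {rs : List (Label n × Label n)} (hrun : B.Run lab' rs) :
    A.Run lab (rs.map (Prod.map drop.succAbove drop.succAbove)) := by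
  induction hrun generalizing lab with
  | done lab' h' =>
    refine Run.done _ fun e he h0 => ?_
    induction e with
    | _ p q =>
      obtain ⟨p, rfl, hp⟩ := hr.exists_map_eq (u := p) ⟨he, by simp⟩ h0
      obtain ⟨e, he', hee⟩ := h.exists_incidenceSet_map_eq hp ⟨he, by simp⟩
      rw [← hee, hr.eq_none_iff] at h0
      exact h' e he'.1 h0
  | round lab' x y E rs hf _ ih =>
    exact Run.round _ _ _ (E.map φ) _ (hr.facesOff_iff.2 hf)
      (ih (hr.advance hf.1.mem_edgeSet hf.1.eq_none))

theorem exists_run (hr : h.Restricts lab lab') {rs : List (Label (n + 1) × Label (n + 1))}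
    (hrun : A.Run lab rs) :
    ∃ rs', rs = rs'.map (Prod.map drop.succAbove drop.succAbove) ∧ B.Run lab' rs' := by
  induction hrun generalizing lab' with
  | done lab h' =>
    exact ⟨[], rfl, Run.done _ fun _ he h0 =>
      h' _ (φ.map_mem_edgeSet_iff.2 he) (hr.eq_none_iff.2 h0)⟩
  | round lab x y E rs hf _ ih =>
    obtain ⟨x, y, E, rfl, rfl, rfl, hc⟩ := hr.exists_canFaceOff hf.1
    obtain ⟨rs', rfl, hrun⟩ := ih (hr.advance hc.mem_edgeSet hc.eq_none)
    exact ⟨(x, y) :: rs', rfl, Run.round _ _ _ E _ (hr.facesOff_iff.1 hf) hrun⟩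

end Restricts

theorem map_eq_third_edge (h : A.PrunesTo v w keep drop B φ) {e : Sym2 B.V}
    (he : e ∈ B.G.edgeSet) (hv : v ∈ e.map φ) : e.map φ = s(v, w) := by
  have hne : ∀ t, (∀ u, φ u ≠ t) → e.map φ ≠ s(v, t) := by
    intro t ht het
    obtain ⟨u, -, hu⟩ := Sym2.mem_map.1 (het ▸ Sym2.mem_mk_right v t : t ∈ e.map φ)
    exact ht u hu
  rcases h.cherry.mem_incidenceSet_iff.1 ⟨φ.map_mem_edgeSet_iff.2 he, hv⟩ with h' | h' | h'
  · exact absurd h' (hne _ h.ne_keep)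
  · exact absurd h' (hne _ h.ne_drop)
  · exact h'

theorem initial_map_of_eq (h : A.PrunesTo v w keep drop B φ) {e : Sym2 B.V}
    (he : e.map φ = s(v, w)) : (B.initial e).map drop.succAbove = some keep := by
  obtain ⟨y, hy, hyv⟩ := h.exists_succAbove_eq
  have hmem : φ (B.leaf y) ∈ e.map φ := by simp [hyv, he]
  rw [initial_eq_some_iff.2 ⟨φ.map_mem_edgeSet_iff.1 (he ▸ h.cherry.adj_third),
    map_mem_map_iff.1 hmem⟩, Option.map_some, hy]

theorem initial_map_of_ne (h : A.PrunesTo v w keep drop B φ) {e : Sym2 B.V}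
    (he : e.map φ ≠ s(v, w)) : A.initial (e.map φ) = (B.initial e).map drop.succAbove := by
  refine Option.ext fun x => ?_
  simp only [initial_eq_some_iff, Option.map_eq_some_iff, φ.map_mem_edgeSet_iff]
  constructor
  · rintro ⟨hedge, hx⟩
    obtain ⟨u, hu, hux⟩ := Sym2.mem_map.1 hx
    have hxk : x ≠ keep := fun h' => h.ne_keep u (h' ▸ hux)
    have hxd : x ≠ drop := fun h' => h.ne_drop u (h' ▸ hux)
    obtain ⟨x', rfl⟩ := Fin.exists_succAbove_eq hxd
    rw [← h.map_leaf_of_ne hxk] at hux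
    exact ⟨x', ⟨hedge, φ.injective hux ▸ hu⟩, rfl⟩
  · rintro ⟨x', ⟨hedge, hx⟩, rfl⟩
    have hmem := map_mem_map_iff (φ := φ).2 hx
    rw [h.map_leaf] at hmem
    split_ifs at hmem
    · exact absurd (h.map_eq_third_edge hedge hmem) he
    · exact ⟨hedge, hmem⟩

open scoped Classical in
theorem restricts (h : A.PrunesTo v w keep drop B φ) :
    h.Restricts (Function.update A.initial s(v, w) (some keep)) B.initial := by
  refine ⟨fun e => ?_, fun e he h0 => ?_⟩
  · by_cases he : e.map φ = s(v, w)
    · rw [he, Function.update_self, h.initial_map_of_eq he]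
    · rw [Function.update_of_ne he, h.initial_map_of_ne he]
  · obtain ⟨hne, h0⟩ := ne_and_eq_none_of_update_eq_none h0
    rcases h.cherry.mem_incidenceSet_iff.1 he with rfl | rfl | rfl
    · simp [initial_leaf_edge h.cherry.adj_left] at h0
    · simp [initial_leaf_edge h.cherry.adj_right] at h0
    · exact hne rfl

end PrunesTo

section Prune

variable {A : TrivalentTree (n + 1)} {v w : A.V} {keep drop : Label (n + 1)}

namespace IsCherry

theorem eq_of_adj_of_removed (hc : A.IsCherry v w keep drop) {x y : A.V}
    (hx : x ∉ {u | u ≠ A.leaf keep ∧ u ≠ A.leaf drop}) (hxy : A.G.Adj x y) : y = v := by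
  rw [Set.mem_ofPred_eq, not_and_or, not_not, not_not] at hx
  obtain rfl | rfl := hx
  · exact eq_of_adj_leaf hxy.symm hc.adj_left
  · exact eq_of_adj_leaf hxy.symm hc.adj_right

/-- The vertex that carries the label `y` once the leaves `keep` and `drop` are removed and `v` gets
the label `keep`. -/
noncomputable def prunedLeaf (hc : A.IsCherry v w keep drop) (y : Label n) :
    {u | u ≠ A.leaf keep ∧ u ≠ A.leaf drop} :=
  if h : drop.succAbove y = keep then ⟨v, hc.ne_leaf _, hc.ne_leaf _⟩
  else ⟨A.leaf (drop.succAbove y), A.leaf_injective.ne h,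
    A.leaf_injective.ne (Fin.succAbove_ne _ _)⟩

theorem coe_prunedLeaf (hc : A.IsCherry v w keep drop) (y : Label n) :
    (hc.prunedLeaf y : A.V) =
      if drop.succAbove y = keep then v else A.leaf (drop.succAbove y) := by
  unfold prunedLeaf
  split_ifs <;> rfl

theorem prunedLeaf_injective (hc : A.IsCherry v w keep drop) :
    Function.Injective hc.prunedLeaf := by
  intro y z hyz
  have hyz := congrArg Subtype.val hyz
  rw [coe_prunedLeaf, coe_prunedLeaf] at hyz
  split_ifs at hyz with hy hz hz
  · exact Fin.succAbove_right_injective (hy.trans hz.symm)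
  · exact absurd hyz (hc.ne_leaf _)
  · exact absurd hyz.symm (hc.ne_leaf _)
  · exact Fin.succAbove_right_injective (A.leaf_injective hyz)

theorem exists_prunedLeaf_eq_iff (hc : A.IsCherry v w keep drop)
    (u : {u | u ≠ A.leaf keep ∧ u ≠ A.leaf drop}) :
    (∃ y, hc.prunedLeaf y = u) ↔ (u : A.V) = v ∨ ∃ x, A.leaf x = u := by
  simp only [← Subtype.val_inj, coe_prunedLeaf]
  constructor
  · rintro ⟨y, hy⟩
    split_ifs at hy
    exacts [Or.inl hy.symm, Or.inr ⟨_, hy⟩]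
  · rintro (hu | ⟨x, hx⟩)
    · obtain ⟨y, hy⟩ := Fin.exists_succAbove_eq hc.ne
      exact ⟨y, by rw [if_pos hy, hu]⟩
    · have hxk : x ≠ keep := fun h => u.2.1 (h ▸ hx.symm)
      obtain ⟨y, rfl⟩ := Fin.exists_succAbove_eq fun h : x = drop => u.2.2 (h ▸ hx.symm)
      exact ⟨y, by rw [if_neg hxk, hx]⟩

open scoped Classical in
theorem ncard_neighborSet_induce (hc : A.IsCherry v w keep drop)
    (u : {u | u ≠ A.leaf keep ∧ u ≠ A.leaf drop}) :
    ((A.G.induce {u | u ≠ A.leaf keep ∧ u ≠ A.leaf drop}).neighborSet u).ncard =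
      if (u : A.V) = v then 1 else (A.G.neighborSet u).ncard := by
  split_ifs with hu
  · refine Set.ncard_eq_one.2 ⟨⟨w, hc.third_ne_left, hc.third_ne_right⟩, Set.ext fun t => ?_⟩
    rw [SimpleGraph.mem_neighborSet, SimpleGraph.induce_adj, hu, hc.adj_iff, Set.mem_singleton_iff,
      Subtype.ext_iff, or_iff_right t.2.1, or_iff_right t.2.2]
  · refine ncard_neighborSet_of_embedding (SimpleGraph.Embedding.induce _) fun t ht => ?_
    refine ⟨⟨t, ?_⟩, rfl⟩
    by_contra h
    exact hu (hc.eq_of_adj_of_removed h (SimpleGraph.Adj.symm ht))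

/-- The tree that is left when the leaves `keep` and `drop` are removed and `v` gets the label
`keep`. -/
noncomputable def prune (hc : A.IsCherry v w keep drop) : TrivalentTree n where
  V := {u | u ≠ A.leaf keep ∧ u ≠ A.leaf drop}
  finite := have := A.finite; inferInstance
  G := A.G.induce _
  isTree := ⟨connected_induce_of_adj_eq A.isTree.connected ⟨hc.ne_leaf _, hc.ne_leaf _⟩
    fun _ hx _ => hc.eq_of_adj_of_removed hx, A.isTree.isAcyclic.induce _⟩
  degree u := by
    classical
    rw [hc.ncard_neighborSet_induce]
    split_ifs
    exacts [Or.inl rfl, A.degree u]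
  leaf := hc.prunedLeaf
  leaf_injective := hc.prunedLeaf_injective
  leaf_range u := by
    classical
    rw [hc.ncard_neighborSet_induce, hc.exists_prunedLeaf_eq_iff, A.leaf_range]
    split_ifs with hu <;> simp [hu]

theorem exists_prunesTo (hc : A.IsCherry v w keep drop) :
    ∃ (B : TrivalentTree n) (φ : B.G ↪g A.G), A.PrunesTo v w keep drop B φ :=
  ⟨hc.prune, SimpleGraph.Embedding.induce _, hc, Subtype.range_coe,
    hc.coe_prunedLeaf⟩

theorem map {A A' : TrivalentTree n} {v w : A.V} {i j : Label n} (hc : A.IsCherry v w i j)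
    (ψ : A.G ≃g A'.G) (hψ : ∀ x, ψ (A.leaf x) = A'.leaf x) :
    A'.IsCherry (ψ v) (ψ w) i j where
  ne := hc.ne
  third_ne_left := by rw [← hψ]; exact ψ.injective.ne hc.third_ne_left
  third_ne_right := by rw [← hψ]; exact ψ.injective.ne hc.third_ne_right
  neighborSet_eq := by
    ext t
    obtain ⟨t, rfl⟩ := ψ.surjective t
    simp only [SimpleGraph.mem_neighborSet, ψ.map_adj_iff, hc.adj_iff, ← hψ, Set.mem_insert_iff,
      Set.mem_singleton_iff, ψ.injective.eq_iff]

end IsCherry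

namespace PrunesTo

variable {B B' : TrivalentTree n} {φ : B.G ↪g A.G}

theorem equiv {φ' : B'.G ↪g A.G} (h : A.PrunesTo v w keep drop B φ)
    (h' : A.PrunesTo v w keep drop B' φ') : B ≈ B' := by
  have hf : ∀ u, ∃ u', φ' u' = φ u := fun u => h'.exists_map_eq (h.ne_keep u) (h.ne_drop u)
  have hg : ∀ u', ∃ u, φ u = φ' u' := fun u => h.exists_map_eq (h'.ne_keep u) (h'.ne_drop u)
  choose f hf using hf
  choose g hg using hg
  refine ⟨⟨⟨f, g, fun u => φ.injective (by rw [hg, hf]), fun u => φ'.injective (by rw [hf, hg])⟩,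
    fun {a b} => ?_⟩, fun x => φ'.injective ?_⟩
  · change B'.G.Adj (f a) (f b) ↔ _
    rw [← φ'.map_adj_iff, hf, hf, φ.map_adj_iff]
  · change φ' (f _) = _
    rw [hf, h.map_leaf, h'.map_leaf]

theorem trans_equiv (h : A.PrunesTo v w keep drop B φ) (hB : B ≈ B') :
    ∃ φ', A.PrunesTo v w keep drop B' φ' := by
  obtain ⟨ψ, hψ⟩ := hB
  refine ⟨ψ.symm.toRelEmbedding.trans φ, h.cherry, ?_, fun y => ?_⟩
  · rw [← h.range_eq]
    exact ψ.symm.surjective.range_comp φ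
  · rw [← h.map_leaf, ← hψ]
    exact congrArg φ (ψ.symm_apply_apply _)

theorem map {A' : TrivalentTree (n + 1)} (h : A.PrunesTo v w keep drop B φ) (ψ : A.G ≃g A'.G)
    (hψ : ∀ x, ψ (A.leaf x) = A'.leaf x) :
    A'.PrunesTo (ψ v) (ψ w) keep drop B (φ.trans ψ.toRelEmbedding) := by
  refine ⟨h.cherry.map ψ hψ, Set.ext fun u => ?_, fun y => ?_⟩
  · obtain ⟨u, rfl⟩ := ψ.surjective u
    rw [Set.mem_ofPred_eq, ← hψ, ← hψ, ψ.injective.ne_iff, ψ.injective.ne_iff,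
      ← Set.mem_ofPred_eq (p := fun w => w ≠ A.leaf keep ∧ w ≠ A.leaf drop), ← h.range_eq]
    exact exists_congr fun t => ψ.injective.eq_iff
  · change ψ (φ _) = _
    rw [h.map_leaf, apply_ite ψ, hψ]

end PrunesTo

end Prune

section Graft

variable {V : Type} {G : SimpleGraph V} {l : V}

/-- The graph `G` with two new vertices, both adjacent to `l` only. -/
def graftGraph (G : SimpleGraph V) (l : V) : SimpleGraph (V ⊕ Bool) where
  Adj
    | .inl x, .inl y => G.Adj x y
    | .inl x, .inr _ => x = l
    | .inr _, .inl y => y = l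
    | .inr _, .inr _ => False
  symm := ⟨by
    rintro (x | x) (y | y) h
    exacts [SimpleGraph.Adj.symm h, h, h, h]⟩
  loopless := ⟨by
    rintro (x | x) h
    exacts [SimpleGraph.irrefl _ h, h]⟩

theorem graftGraph_connected (hG : G.Connected) : (graftGraph G l).Connected := by
  have hinl : ∀ x, (graftGraph G l).Reachable (.inl l) (.inl x) :=
    mem_of_preconnected_of_adj_closed hG.preconnected
      (S := {x | (graftGraph G l).Reachable (.inl l) (.inl x)}) (.refl _)
      fun _ hx _ hxy => hx.trans (SimpleGraph.Adj.reachable (by exact hxy))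
  have hl : ∀ x, (graftGraph G l).Reachable (.inl l) x := by
    rintro (x | b)
    · exact hinl x
    · exact SimpleGraph.Adj.reachable (by exact rfl)
  have : Nonempty (V ⊕ Bool) := ⟨.inl l⟩
  exact ⟨fun x y => (hl x).symm.trans (hl y)⟩

theorem graftGraph_isTree [Finite V] (hG : G.IsTree) : (graftGraph G l).IsTree := by
  rw [SimpleGraph.isTree_iff_connected_and_card] at hG ⊢
  have hconn := graftGraph_connected (l := l) hG.1
  refine ⟨hconn, le_antisymm ?_ hconn.card_vert_le_card_edgeSet_add_one⟩
  let f : G.edgeSet ⊕ Bool → (graftGraph G l).edgeSet := Sum.elim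
    (fun e => ⟨e.1.map Sum.inl, by
      obtain ⟨e, he⟩ := e
      induction e with
      | _ x y => exact he⟩)
    (fun b => ⟨s(.inl l, .inr b), rfl⟩)
  have hf : Function.Surjective f := by
    rintro ⟨e, he⟩
    induction e with
    | _ x y =>
      rcases x with x | x <;> rcases y with y | y
      · exact ⟨.inl ⟨s(x, y), he⟩, rfl⟩
      · obtain rfl : x = l := he
        exact ⟨.inr y, rfl⟩
      · obtain rfl : y = l := he
        exact ⟨.inr x, Subtype.ext Sym2.eq_swap⟩
      · exact he.elim
  have hcard := Nat.card_le_card_of_surjective f hf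
  rw [Nat.card_sum, Nat.card_eq_fintype_card (α := Bool), Fintype.card_bool] at hcard
  rw [Nat.card_sum, Nat.card_eq_fintype_card (α := Bool), Fintype.card_bool, ← hG.2]
  omega

theorem ncard_neighborSet_graftGraph_inr (b : Bool) :
    ((graftGraph G l).neighborSet (.inr b)).ncard = 1 := by
  refine Set.ncard_eq_one.2 ⟨.inl l, Set.ext fun t => ?_⟩
  rcases t with t | t <;> simp [graftGraph]

theorem ncard_neighborSet_graftGraph_of_ne {u : V} (hu : u ≠ l) :
    ((graftGraph G l).neighborSet (.inl u)).ncard = (G.neighborSet u).ncard := by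
  symm
  refine ncard_neighborSet_of_embedding (G' := graftGraph G l) ⟨Function.Embedding.inl, Iff.rfl⟩ ?_
  rintro (t | t) ht
  · exact ⟨t, rfl⟩
  · exact absurd ht hu

theorem neighborSet_graftGraph_inl {w : V} (hw : G.neighborSet l = {w}) :
    (graftGraph G l).neighborSet (.inl l) = {.inr true, .inr false, .inl w} := by
  ext (t | t)
  · have ht : t ∈ G.neighborSet l ↔ t = w := by rw [hw, Set.mem_singleton_iff]
    simpa [graftGraph, SimpleGraph.mem_neighborSet] using ht
  · cases t <;> simp [graftGraph]

variable {B : TrivalentTree n} {y : Label n} {drop : Label (n + 1)}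

/-- The leaves of the tree in which the leaf `y` of `B` is replaced by a cherry: the new leaf
`.inr false` has the label `drop`, and the other labels are renumbered to make room for it. -/
def graftLeaf (B : TrivalentTree n) (y : Label n) (drop : Label (n + 1)) :
    Label (n + 1) → B.V ⊕ Bool :=
  drop.insertNth (α := fun _ => B.V ⊕ Bool) (.inr false)
    fun z => if z = y then .inr true else .inl (B.leaf z)

@[simp]
theorem graftLeaf_drop : graftLeaf B y drop drop = .inr false := Fin.insertNth_apply_same ..

@[simp]
theorem graftLeaf_succAbove (z : Label n) : graftLeaf B y drop (drop.succAbove z) =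
    if z = y then .inr true else .inl (B.leaf z) := Fin.insertNth_apply_succAbove ..

theorem graftLeaf_injective : Function.Injective (graftLeaf B y drop) := by
  simp only [Function.Injective, Fin.forall_iff_succAbove drop, graftLeaf_drop, graftLeaf_succAbove]
  refine ⟨⟨fun _ => trivial, fun z h => ?_⟩, fun z => ⟨fun h => ?_, fun z' h => ?_⟩⟩ <;>
    split_ifs at h <;> simp_all [B.leaf_injective.eq_iff]

theorem exists_graftLeaf_eq_inl {u : B.V} :
    (∃ x, graftLeaf B y drop x = .inl u) ↔ u ≠ B.leaf y ∧ ∃ z, B.leaf z = u := by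
  simp only [Fin.exists_iff_succAbove drop, graftLeaf_drop, graftLeaf_succAbove, reduceCtorEq,
    false_or]
  constructor
  · rintro ⟨z, hz⟩
    split_ifs at hz with hzy
    rw [← Sum.inl.inj hz]
    exact ⟨B.leaf_injective.ne hzy, z, rfl⟩
  · rintro ⟨hu, z, rfl⟩
    exact ⟨z, if_neg (by rintro rfl; exact hu rfl)⟩

theorem exists_graftLeaf_eq_inr (b : Bool) : ∃ x, graftLeaf B y drop x = .inr b := by
  cases b
  exacts [⟨drop, graftLeaf_drop⟩, ⟨drop.succAbove y, by rw [graftLeaf_succAbove, if_pos rfl]⟩]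

/-- The tree in which the leaf `y` of `B` is replaced by a cherry. Its leaves are labelled as in
`graftLeaf`, so that `B` is what is left when this cherry is pruned. -/
def graft (B : TrivalentTree n) (y : Label n) (drop : Label (n + 1)) : TrivalentTree (n + 1) where
  V := B.V ⊕ Bool
  finite := have := B.finite; inferInstance
  G := graftGraph B.G (B.leaf y)
  isTree := have := B.finite; graftGraph_isTree B.isTree
  degree := by
    rintro (u | b)
    · by_cases hu : u = B.leaf y
      · obtain ⟨w, hw⟩ := Set.ncard_eq_one.1 (B.ncard_neighborSet_leaf y)
        rw [hu, neighborSet_graftGraph_inl hw]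
        exact Or.inr (Set.ncard_eq_three.2 ⟨_, _, _, by simp, by simp, by simp, rfl⟩)
      · rw [ncard_neighborSet_graftGraph_of_ne hu]
        exact B.degree u
    · exact Or.inl (ncard_neighborSet_graftGraph_inr b)
  leaf := graftLeaf B y drop
  leaf_injective := graftLeaf_injective
  leaf_range := by
    rintro (u | b)
    · rw [exists_graftLeaf_eq_inl]
      by_cases hu : u = B.leaf y
      · obtain ⟨w, hw⟩ := Set.ncard_eq_one.1 (B.ncard_neighborSet_leaf y)
        rw [hu, neighborSet_graftGraph_inl hw, Set.ncard_eq_three.2 ⟨_, _, _, by simp, by simp,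
          by simp, rfl⟩]
        simp
      · rw [ncard_neighborSet_graftGraph_of_ne hu, ← B.leaf_range, and_iff_right hu]
    · exact iff_of_true (exists_graftLeaf_eq_inr b) (ncard_neighborSet_graftGraph_inr b)

theorem exists_prunesTo (B : TrivalentTree n) {keep drop : Label (n + 1)} (hne : keep ≠ drop) :
    ∃ (A : TrivalentTree (n + 1)) (v w : A.V) (φ : B.G ↪g A.G),
      A.PrunesTo v w keep drop B φ := by
  obtain ⟨y, rfl⟩ := Fin.exists_succAbove_eq hne
  obtain ⟨w, hw⟩ := Set.ncard_eq_one.1 (B.ncard_neighborSet_leaf y)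
  have hkeep : graftLeaf B y drop (drop.succAbove y) = .inr true := by simp
  have hrange : Set.range Sum.inl = {u | u ≠ graftLeaf B y drop (drop.succAbove y) ∧
      u ≠ graftLeaf B y drop drop} := by
    rw [hkeep, graftLeaf_drop]
    ext (t | (_ | _)) <;> simp
  have hleaf : ∀ z, Sum.inl (B.leaf z) = if drop.succAbove z = drop.succAbove y
      then Sum.inl (B.leaf y) else graftLeaf B y drop (drop.succAbove z) := by
    intro z
    by_cases hz : z = y <;> simp [hz]
  refine ⟨graft B y drop, .inl (B.leaf y), .inl w, ⟨Function.Embedding.inl, Iff.rfl⟩,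
    ⟨hne, ?_, ?_, ?_⟩, hrange, hleaf⟩
  · exact Sum.inl_ne_inr.trans_eq hkeep.symm
  · exact Sum.inl_ne_inr.trans_eq graftLeaf_drop.symm
  · refine (neighborSet_graftGraph_inl hw).trans ?_
    rw [← hkeep, ← graftLeaf_drop (y := y)]
    rfl

namespace PrunesTo

variable {A : TrivalentTree (n + 1)} {v w : A.V} {keep drop : Label (n + 1)}
  {φ : B.G ↪g A.G}

theorem equiv_graft (h : A.PrunesTo v w keep drop B φ) (hy : drop.succAbove y = keep) :
    graft B y drop ≈ A := by
  let f : B.V ⊕ Bool → A.V := Sum.elim φ fun b => if b then A.leaf keep else A.leaf drop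
  have hne := A.leaf_injective.ne h.cherry.ne
  have hf : Function.Bijective f := by
    refine ⟨?_, fun u => ?_⟩
    · rintro (a | (_ | _)) (b | (_ | _)) hab <;>
        simp_all [f, h.ne_keep, h.ne_drop, (h.ne_keep _).symm, (h.ne_drop _).symm, hne.symm]
    · by_cases hk : u = A.leaf keep
      · exact ⟨.inr true, hk.symm⟩
      by_cases hd : u = A.leaf drop
      · exact ⟨.inr false, hd.symm⟩
      obtain ⟨u', rfl⟩ := h.exists_map_eq hk hd
      exact ⟨.inl u', rfl⟩
  have hadj : ∀ u b, A.G.Adj (φ u) (f (.inr b)) ↔ u = B.leaf y := by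
    intro u b
    have hv : A.G.Adj v (f (.inr b)) := by cases b; exacts [h.cherry.adj_right, h.cherry.adj_left]
    rw [← φ.injective.eq_iff, h.map_leaf, if_pos hy]
    refine ⟨fun h' => ?_, fun h' => h' ▸ hv⟩
    cases b <;> exact eq_of_adj_leaf h' hv
  refine ⟨⟨Equiv.ofBijective f hf, fun {a b} => ?_⟩, (Fin.forall_iff_succAbove drop).2 ⟨?_, ?_⟩⟩
  · change A.G.Adj (f a) (f b) ↔ (graftGraph B.G (B.leaf y)).Adj a b
    rcases a with a | a <;> rcases b with b | b
    · exact φ.map_adj_iff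
    · exact hadj a b
    · exact (SimpleGraph.adj_comm _ _ _).trans (hadj b a)
    · refine iff_of_false ?_ id
      cases a <;> cases b <;> exact not_adj_leaf_leaf _ _
  · exact congrArg f graftLeaf_drop
  · intro z
    refine (congrArg f (graftLeaf_succAbove z)).trans ?_
    subst hy
    split_ifs with hz
    · rw [hz]; rfl
    · exact h.map_leaf_of_ne (Fin.succAbove_right_injective.ne hz)

theorem equiv_of_equiv {A' : TrivalentTree (n + 1)} {v' w' : A'.V} {B' : TrivalentTree n}
    {φ' : B'.G ↪g A'.G} (h : A.PrunesTo v w keep drop B φ)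
    (h' : A'.PrunesTo v' w' keep drop B' φ') (hB : B ≈ B') : A ≈ A' := by
  obtain ⟨φ, h⟩ := h.trans_equiv hB
  obtain ⟨y, hy⟩ := Fin.exists_succAbove_eq h.cherry.ne
  exact Setoid.trans (Setoid.symm (h.equiv_graft hy)) (h'.equiv_graft hy)

end PrunesTo

end Graft

section First

/-- The leaves `i < j` of the cherry at `v` are the first pair to face off; `w` is the third
neighbour of `v`. -/
structure IsFirst (T : TrivalentTree (n + 1)) (i j : Label (n + 1)) (v w : T.V) : Prop where
  lt : i < j
  cherry : T.IsCherry v w i j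
  le : ∀ v' w' i' j', i' < j' → T.IsCherry v' w' i' j' → i' ≤ i

variable {T : TrivalentTree (n + 1)} {i j : Label (n + 1)} {v w : T.V}

theorem exists_isFirst (hT : T.ABShareVertex) : ∃ i j v w, T.IsFirst i j v w := by
  obtain ⟨v₀, w₀, i₀, j₀, -, hlt, hc⟩ := exists_isCherry_two_le hT
  obtain ⟨i, ⟨v, w, j, hij, hc'⟩, hmax⟩ := Set.exists_max_image
    {i | ∃ v w j, i < j ∧ T.IsCherry v w i j} id (Set.toFinite _) ⟨i₀, v₀, w₀, j₀, hlt, hc⟩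
  exact ⟨i, j, v, w, hij, hc', fun v' w' i' j' h h' => hmax i' ⟨v', w', j', h, h'⟩⟩

theorem facesOff_initial_iff {E : Sym2 T.V} :
    T.FacesOff T.initial i j E ↔ ∃ v w, T.IsFirst i j v w ∧ E = s(v, w) := by
  simp only [FacesOff, canFaceOff_initial_iff]
  constructor
  · rintro ⟨⟨hij, v, w, hc, rfl⟩, hmax⟩
    exact ⟨v, w, ⟨hij, hc, fun v' w' i' j' h h' => hmax i' j' _ ⟨h, v', w', h', rfl⟩⟩, rfl⟩
  · rintro ⟨v, w, h, rfl⟩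
    exact ⟨⟨h.lt, v, w, h.cherry, rfl⟩, fun _ _ _ ⟨hlt, v', w', hc, _⟩ => h.le _ _ _ _ hlt hc⟩

theorem firstFaceOff_iff : T.FirstFaceOff i j v ↔ ∃ w, T.IsFirst i j v w := by
  constructor
  · rintro ⟨⟨lab, h0, E, hE⟩, hi, -⟩
    rw [isInitial_iff.1 h0] at hE
    obtain ⟨v', w, h, rfl⟩ := facesOff_initial_iff.1 hE
    obtain rfl := eq_of_adj_leaf h.cherry.adj_left hi
    exact ⟨w, h⟩
  · rintro ⟨w, h⟩
    exact ⟨⟨_, isInitial_initial, _, facesOff_initial_iff.2 ⟨v, w, h, rfl⟩⟩,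
      h.cherry.adj_left, h.cherry.adj_right⟩

theorem mem_of_initial_eq_some {p : T.V} {g F : Sym2 T.V} {x : Label (n + 1)}
    (hv : T.G.Adj v (T.leaf x)) (hg : T.initial g = some x) (hF : F ∈ T.G.edgeSet) (hpg : p ∈ g)
    (hpF : p ∈ F) : v ∈ F := by
  obtain ⟨hedge, t, rfl⟩ := initial_eq_some_iff.1 hg
  obtain rfl := eq_of_adj_leaf (SimpleGraph.Adj.symm hedge) hv
  rcases Sym2.mem_iff.1 hpg with rfl | rfl
  · obtain ⟨t', rfl⟩ := hpF
    rw [eq_of_adj_leaf hv (SimpleGraph.Adj.symm hF)]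
    simp
  · exact hpF

/-- The loser `i` of a first round between `i` and `j` advances: there is a larger leaf other than
`j` next to the edge reached. -/
def LoserAdvances (T : TrivalentTree (n + 1)) (w : T.V) (i j : Label (n + 1)) : Prop :=
  ∃ u, T.G.Adj w (T.leaf u) ∧ u ≠ j ∧ i < u

/-- In the first round between `i` and `j` the label `keep` advances, and `drop` does not. -/
def FirstAdvances (T : TrivalentTree (n + 1)) (w : T.V) (i j keep drop : Label (n + 1)) : Prop :=
  T.LoserAdvances w i j ∧ keep = i ∧ drop = j ∨ ¬T.LoserAdvances w i j ∧ keep = j ∧ drop = i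

variable {keep drop : Label (n + 1)}

theorem exists_firstAdvances (T : TrivalentTree (n + 1)) (w : T.V) (i j : Label (n + 1)) :
    ∃ keep drop, T.FirstAdvances w i j keep drop := by
  by_cases h : T.LoserAdvances w i j
  · exact ⟨i, j, Or.inl ⟨h, rfl, rfl⟩⟩
  · exact ⟨j, i, Or.inr ⟨h, rfl, rfl⟩⟩

theorem FirstAdvances.isCherry (h : T.FirstAdvances w i j keep drop) (hc : T.IsCherry v w i j) :
    T.IsCherry v w keep drop := by
  rcases h with ⟨-, rfl, rfl⟩ | ⟨-, rfl, rfl⟩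
  · exact hc
  · exact hc.symm

open scoped Classical in
theorem FirstAdvances.advance_eq (h : T.FirstAdvances w i j keep drop) (hc : T.IsCherry v w i j) :
    T.advance T.initial i j s(v, w) = Function.update T.initial s(v, w) (some keep) := by
  rw [advance_eq_update]
  rcases h with ⟨h, rfl, rfl⟩ | ⟨h, rfl, rfl⟩
  · rw [if_pos ((lazinessApplies_initial_iff hc).2 h)]
  · rw [if_neg (mt (lazinessApplies_initial_iff hc).1 h)]

namespace IsFirst

variable {rs : List (Label (n + 1) × Label (n + 1))} {B : TrivalentTree n} {φ : B.G ↪g T.G}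

theorem two_le (h : T.IsFirst i j v w) (hT : T.ABShareVertex) : 2 ≤ i.val := by
  obtain ⟨v₀, w₀, i₀, j₀, h2, hlt, hc⟩ := exists_isCherry_two_le hT
  exact h2.trans (h.le _ _ _ _ hlt hc)

theorem unique (h : T.IsFirst i j v w) {i' j' : Label (n + 1)} {v' w' : T.V}
    (h' : T.IsFirst i' j' v' w') : i' = i ∧ j' = j ∧ v' = v ∧ w' = w := by
  obtain rfl : i' = i := le_antisymm (h.le _ _ _ _ h'.lt h'.cherry) (h'.le _ _ _ _ h.lt h.cherry)
  obtain rfl : v' = v := eq_of_adj_leaf h'.cherry.adj_left h.cherry.adj_left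
  obtain rfl : j' = j :=
    (h.cherry.eq_or_eq_of_adj_leaf h'.cherry.adj_right).resolve_left h'.lt.ne'
  refine ⟨rfl, rfl, rfl, ?_⟩
  exact ((h.cherry.adj_iff.1 h'.cherry.adj_third).resolve_left
    (h'.cherry.third_ne_leaf _)).resolve_left (h'.cherry.third_ne_leaf _)

theorem isTournament_iff (h : T.IsFirst i j v w) :
    T.IsTournament rs ↔
      ∃ rs', rs = (i, j) :: rs' ∧ T.Run (T.advance T.initial i j s(v, w)) rs' := by
  rw [isTournament_iff_run]
  constructor
  · rintro (⟨-, h1⟩ | ⟨-, i', j', E, rs', hf, hrun⟩)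
    · exact absurd (initial_eq_none h.cherry.ne_leaf h.cherry.third_ne_leaf)
        (h1 _ h.cherry.adj_third)
    · obtain ⟨v', w', h', rfl⟩ := facesOff_initial_iff.1 hf
      obtain ⟨rfl, rfl, rfl, rfl⟩ := h.unique h'
      exact ⟨rs', rfl, hrun⟩
  · rintro ⟨rs', rfl, hrun⟩
    exact Run.round _ _ _ _ _ (facesOff_initial_iff.2 ⟨v, w, h, rfl⟩) hrun

theorem isTournament_iff_of_prunesTo (h : T.IsFirst i j v w)
    (hp : T.PrunesTo v w keep drop B φ) (hadv : T.FirstAdvances w i j keep drop) :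
    T.IsTournament rs ↔
      ∃ rs', rs = (i, j) :: rs'.map (Prod.map drop.succAbove drop.succAbove) ∧
        B.IsTournament rs' := by
  simp only [h.isTournament_iff, hadv.advance_eq h.cherry, isTournament_iff_run]
  constructor
  · rintro ⟨rs, rfl, hrun⟩
    obtain ⟨rs', rfl, hrun'⟩ := hp.restricts.exists_run hrun
    exact ⟨rs', rfl, hrun'⟩
  · rintro ⟨rs', rfl, hrun⟩
    exact ⟨_, rfl, hp.restricts.run hrun⟩

open scoped Classical in
theorem isIdle (h : T.IsFirst i j v w) (hadv : ¬T.LoserAdvances w i j) :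
    T.IsIdle (Function.update T.initial s(v, w) (some j)) s(v, w) i j := by
  have hadvance := FirstAdvances.advance_eq (Or.inr ⟨hadv, rfl, rfl⟩) h.cherry
  have hne : ∀ g ∈ T.G.edgeSet, g ≠ s(v, w) →
      Function.update T.initial s(v, w) (some j) g = some i ∨
        Function.update T.initial s(v, w) (some j) g = some j →
      ∀ F ∈ T.G.edgeSet, (∃ p, p ∈ g ∧ p ∈ F) →
        Function.update T.initial s(v, w) (some j) F ≠ none := by
    rintro g - hgE hl F hF ⟨p, hpg, hpF⟩ hF0
    obtain ⟨hFE, hF0⟩ := ne_and_eq_none_of_update_eq_none hF0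
    rw [Function.update_of_ne hgE] at hl
    have hFv : F ∈ T.G.incidenceSet v := by
      obtain ⟨x, hx, hgx⟩ : ∃ x, T.G.Adj v (T.leaf x) ∧ T.initial g = some x :=
        hl.elim (⟨i, h.cherry.adj_left, ·⟩) (⟨j, h.cherry.adj_right, ·⟩)
      exact ⟨hF, mem_of_initial_eq_some hx hgx hF hpg hpF⟩
    rcases h.cherry.mem_incidenceSet_iff.1 hFv with rfl | rfl | rfl
    · simp [initial_leaf_edge h.cherry.adj_left] at hF0
    · simp [initial_leaf_edge h.cherry.adj_right] at hF0
    · exact hFE rfl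
  refine ⟨h.lt, Function.update_self .., fun x y F hc => ?_, hne⟩
  refine lt_of_le_of_ne ((facesOff_initial_iff.2 ⟨v, w, h, rfl⟩).le_of_canFaceOff_advance
    (hadvance ▸ hc)) ?_
  rintro rfl
  obtain ⟨-, u, g, hg, -, -, -, hF, hgx, -, hF0⟩ := hc
  refine hne g hg.1 ?_ (Or.inl hgx) F hF.1 ⟨u, hg.2, hF.2⟩ hF0
  rintro rfl
  rw [Function.update_self] at hgx
  exact h.lt.ne' (Option.some.inj hgx)

/-- If the winner `j` of the first round advances but does not win again, the tournament goes on
as if the loser had advanced. -/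
theorem exists_isTournament_of_not_loserAdvances (h : T.IsFirst i j v w)
    (hp : T.PrunesTo v w i j B φ) (hadv : ¬T.LoserAdvances w i j)
    (hT : T.IsTournament ((i, j) :: rs)) (hrs : ∀ p ∈ rs, p.2 ≠ j) :
    ∃ rs', rs = rs'.map (Prod.map j.succAbove j.succAbove) ∧ B.IsTournament rs' := by
  classical
  obtain ⟨_, he, hrun⟩ := h.isTournament_iff.1 hT
  obtain rfl := (List.cons.inj he).2
  rw [FirstAdvances.advance_eq (Or.inr ⟨hadv, rfl, rfl⟩) h.cherry] at hrun
  have hrun' := hrun.update (h.isIdle hadv) hrs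
  rw [Function.update_idem] at hrun'
  simp only [isTournament_iff_run]
  exact hp.restricts.exists_run hrun'

end IsFirst

end First

section PrunedCherries

namespace PrunesTo

variable {A : TrivalentTree (n + 1)} {v w : A.V} {keep drop : Label (n + 1)}
  {B : TrivalentTree n} {φ : B.G ↪g A.G}

theorem abShareVertex_iff (h : A.PrunesTo v w keep drop B φ) (hk : 2 ≤ keep.val)
    (hd : 2 ≤ drop.val) : B.ABShareVertex ↔ A.ABShareVertex := by
  have hleaf : ∀ {x : Label n}, x.val < 2 → φ (B.leaf x) = A.leaf x.castSucc := fun {x} hx => by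
    have hsucc : drop.succAbove x = x.castSucc := Fin.succAbove_of_castSucc_lt _ _ (by
      rw [Fin.lt_def, Fin.val_castSucc]
      omega)
    rw [h.map_leaf_of_ne, hsucc]
    rw [hsucc, Ne, Fin.ext_iff, Fin.val_castSucc]
    omega
  have h0 : φ (B.leaf 0) = A.leaf 0 := hleaf (by simp)
  have h1 : φ (B.leaf 1) = A.leaf 1 := hleaf (by simp)
  constructor
  · rintro ⟨o, ha, hb⟩
    exact ⟨φ o, h0 ▸ φ.map_adj_iff.2 ha, h1 ▸ φ.map_adj_iff.2 hb⟩
  · rintro ⟨o, ha, hb⟩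
    obtain ⟨o, rfl⟩ := h.exists_map_eq (ne_leaf_of_adj ha keep) (ne_leaf_of_adj ha drop)
    exact ⟨o, φ.map_adj_iff.1 (h0 ▸ ha), φ.map_adj_iff.1 (h1 ▸ hb)⟩

theorem adj_third_iff (h : A.PrunesTo v w keep drop B φ) {y u : Label n}
    (hy : drop.succAbove y = keep) (hu : u ≠ y) :
    A.G.Adj w (A.leaf (drop.succAbove u)) ↔ ∃ v' w', B.IsCherry v' w' y u := by
  have hu' : drop.succAbove u ≠ keep := hy ▸ Fin.succAbove_right_injective.ne hu
  have hv : φ (B.leaf y) = v := by rw [h.map_leaf, if_pos hy]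
  rw [← h.map_leaf_of_ne hu']
  constructor
  · intro hadj
    obtain ⟨w, rfl⟩ := h.exists_map_eq h.cherry.third_ne_left h.cherry.third_ne_right
    have hwy : B.G.Adj w (B.leaf y) := φ.map_adj_iff.1 (hv ▸ h.cherry.adj_third.symm)
    exact ⟨w, exists_isCherry hu.symm hwy (φ.map_adj_iff.1 hadj)⟩
  · rintro ⟨v', w', hc⟩
    have hvv' : A.G.Adj v (φ v') := hv ▸ φ.map_adj_iff.2 hc.adj_left.symm
    have hw : φ v' = w :=
      ((h.cherry.adj_iff.1 hvv').resolve_left (h.ne_keep _)).resolve_left (h.ne_drop _)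
    exact hw ▸ φ.map_adj_iff.2 hc.adj_right

theorem exists_isCherry_of_ne (h : A.PrunesTo v w keep drop B φ) {v' w' : A.V}
    {x y : Label (n + 1)} (hc : A.IsCherry v' w' x y) (hv : v' ≠ v) :
    ∃ x' y', x = drop.succAbove x' ∧ y = drop.succAbove y' ∧
      ∃ v'' w'', B.IsCherry v'' w'' x' y' := by
  have hne : ∀ {z}, A.G.Adj v' (A.leaf z) → z ≠ keep ∧ z ≠ drop := fun hz =>
    ⟨fun he => hv (eq_of_adj_leaf (he ▸ hz) h.cherry.adj_left),
      fun he => hv (eq_of_adj_leaf (he ▸ hz) h.cherry.adj_right)⟩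
  have hx := hc.adj_left
  have hy := hc.adj_right
  obtain ⟨x, rfl⟩ := Fin.exists_succAbove_eq (hne hx).2
  obtain ⟨y, rfl⟩ := Fin.exists_succAbove_eq (hne hy).2
  obtain ⟨v', rfl⟩ := h.exists_map_eq (hc.ne_leaf keep) (hc.ne_leaf drop)
  rw [← h.map_leaf_of_ne (hne hx).1, φ.map_adj_iff] at hx
  rw [← h.map_leaf_of_ne (hne hy).1, φ.map_adj_iff] at hy
  exact ⟨x, y, rfl, rfl, v', exists_isCherry (fun he => hc.ne (congrArg _ he)) hx hy⟩

theorem isCherry_cases (h : A.PrunesTo v w keep drop B φ) {v' w' : A.V} {x y : Label (n + 1)}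
    (hc : A.IsCherry v' w' x y) :
    x = keep ∧ y = drop ∨ x = drop ∧ y = keep ∨
      ∃ x' y', x = drop.succAbove x' ∧ y = drop.succAbove y' ∧
        ∃ v'' w'', B.IsCherry v'' w'' x' y' := by
  by_cases hv : v' = v
  · subst hv
    have hne := hc.ne
    rcases h.cherry.eq_or_eq_of_adj_leaf hc.adj_left with rfl | rfl <;>
      rcases h.cherry.eq_or_eq_of_adj_leaf hc.adj_right with rfl | rfl <;> simp_all
  · exact Or.inr (Or.inr (h.exists_isCherry_of_ne hc hv))

end PrunesTo

end PrunedCherries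

section SizeZero

variable {T : TrivalentTree 0} {v w : T.V}

theorem eq_of_ne_leaf (hv : ∀ x, v ≠ T.leaf x) (hw : ∀ x, w ≠ T.leaf x) : v = w := by
  have := T.finite
  exact (Set.ncard_le_one_iff).1 (ncard_internal T).le hv hw

theorem adj_leaf_of_ne_leaf (hv : ∀ x, v ≠ T.leaf x) (x : Label 0) : T.G.Adj v (T.leaf x) := by
  obtain ⟨w, hw⟩ := exists_adj_leaf (T := T) x
  rwa [eq_of_ne_leaf hv (ne_leaf_of_adj hw)]

theorem initial_ne_none {e : Sym2 T.V} (he : e ∈ T.G.edgeSet) : T.initial e ≠ none := by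
  induction e with | _ p q =>
  by_contra h0
  have hleaf : ∀ {u}, u ∈ s(p, q) → ∀ x, u ≠ T.leaf x := by
    rintro _ hu x rfl
    simp [initial_eq_some_iff.2 ⟨he, hu⟩] at h0
  exact T.G.ne_of_adj he (eq_of_ne_leaf (hleaf (by simp)) (hleaf (by simp)))

theorem isTournament_zero_iff {rs : List (Label 0 × Label 0)} :
    T.IsTournament rs ↔ rs = [] := by
  rw [isTournament_iff_run]
  constructor
  · rintro (_ | ⟨-, i, j, E, rs, hf, -⟩)
    · rfl
    · exact absurd hf.1.eq_none (initial_ne_none hf.1.mem_edgeSet)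
  · rintro rfl
    exact Run.done _ fun e he => initial_ne_none he

end SizeZero

section Rounds

namespace IsFirst

theorem exists_prunesTo {T : TrivalentTree (n + 1)} {i j : Label (n + 1)} {v w : T.V}
    (hf : T.IsFirst i j v w) (hT : T.ABShareVertex) :
    ∃ keep drop, T.FirstAdvances w i j keep drop ∧
      ∃ (B : TrivalentTree n) (φ : B.G ↪g T.G),
        T.PrunesTo v w keep drop B φ ∧ B.ABShareVertex := by
  obtain ⟨keep, drop, hadv⟩ := exists_firstAdvances T w i j
  obtain ⟨B, φ, hp⟩ := (hadv.isCherry hf.cherry).exists_prunesTo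
  have hi := hf.two_le hT
  have hj := hi.trans (Fin.le_def.1 hf.lt.le)
  refine ⟨keep, drop, hadv, B, φ, hp, ?_⟩
  rcases hadv with ⟨-, rfl, rfl⟩ | ⟨-, rfl, rfl⟩
  · exact (hp.abShareVertex_iff hi hj).2 hT
  · exact (hp.abShareVertex_iff hj hi).2 hT

theorem succAbove_le {T : TrivalentTree (n + 2)} {i j keep drop : Label (n + 2)} {v w : T.V}
    (hf : T.IsFirst i j v w) (hadv : T.FirstAdvances w i j keep drop) {B : TrivalentTree (n + 1)}
    {φ : B.G ↪g T.G} (hp : T.PrunesTo v w keep drop B φ) {i' j' : Label (n + 1)} {v' w' : B.V}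
    (hf' : B.IsFirst i' j' v' w') : drop.succAbove i' ≤ i := by
  classical
  have hc := (facesOff_initial_iff.2 ⟨v', w', hf', rfl⟩).1
  have hc' := hp.restricts.canFaceOff hc
  rw [← hadv.advance_eq hf.cherry] at hc'
  exact (facesOff_initial_iff.2 ⟨v, w, hf, rfl⟩).le_of_canFaceOff_advance hc'

end IsFirst

theorem exists_isTournament {T : TrivalentTree n} (hT : T.ABShareVertex) :
    ∃ rs, T.IsTournament rs := by
  induction n with
  | zero => exact ⟨[], isTournament_zero_iff.2 rfl⟩
  | succ n ih =>
    obtain ⟨i, j, v, w, hf⟩ := exists_isFirst hT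
    obtain ⟨keep, drop, hadv, B, φ, hp, hB⟩ := hf.exists_prunesTo hT
    obtain ⟨rs, hrs⟩ := ih hB
    exact ⟨_, (hf.isTournament_iff_of_prunesTo hp hadv).2 ⟨rs, rfl, hrs⟩⟩

namespace IsTournament

theorem unique {T : TrivalentTree n} (hT : T.ABShareVertex) {rs rs' : List (Label n × Label n)}
    (h : T.IsTournament rs) (h' : T.IsTournament rs') : rs = rs' := by
  induction n with
  | zero => rw [isTournament_zero_iff.1 h, isTournament_zero_iff.1 h']
  | succ n ih =>
    obtain ⟨i, j, v, w, hf⟩ := exists_isFirst hT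
    obtain ⟨keep, drop, hadv, B, φ, hp, hB⟩ := hf.exists_prunesTo hT
    obtain ⟨rs, rfl, hrs⟩ := (hf.isTournament_iff_of_prunesTo hp hadv).1 h
    obtain ⟨rs', rfl, hrs'⟩ := (hf.isTournament_iff_of_prunesTo hp hadv).1 h'
    rw [ih hB hrs hrs']

theorem length_eq {T : TrivalentTree n} (hT : T.ABShareVertex) {rs : List (Label n × Label n)}
    (h : T.IsTournament rs) : rs.length = n := by
  induction n with
  | zero => simp [isTournament_zero_iff.1 h]
  | succ n ih =>
    obtain ⟨i, j, v, w, hf⟩ := exists_isFirst hT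
    obtain ⟨keep, drop, hadv, B, φ, hp, hB⟩ := hf.exists_prunesTo hT
    obtain ⟨rs, rfl, hrs⟩ := (hf.isTournament_iff_of_prunesTo hp hadv).1 h
    simp [ih hB hrs]

theorem three_le_winner {T : TrivalentTree n} (hT : T.ABShareVertex)
    {rs : List (Label n × Label n)} (h : T.IsTournament rs) : ∀ p ∈ rs, 3 ≤ p.2.val := by
  induction n with
  | zero => simp [isTournament_zero_iff.1 h]
  | succ n ih =>
    obtain ⟨i, j, v, w, hf⟩ := exists_isFirst hT
    obtain ⟨keep, drop, hadv, B, φ, hp, hB⟩ := hf.exists_prunesTo hT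
    obtain ⟨rs, rfl, hrs⟩ := (hf.isTournament_iff_of_prunesTo hp hadv).1 h
    rw [List.forall_mem_cons, List.forall_mem_map]
    exact ⟨(hf.two_le hT).trans_lt (Fin.lt_def.1 hf.lt),
      fun q hq => (ih hB hrs q hq).trans (val_le_val_succAbove _ _)⟩

end IsTournament

namespace IsFirst

/-- If the first loser `i` advances, a larger leaf `u` is next to it in the pruned tree. Were `i`
to win there, it would be the first loser there, by maximality. -/
theorem winner_ne {T : TrivalentTree (n + 1)} (hT : T.ABShareVertex) {i j : Label (n + 1)}
    {v w : T.V} (hf : T.IsFirst i j v w) {rs : List (Label (n + 1) × Label (n + 1))}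
    (h : T.IsTournament rs) : ∀ p ∈ rs, p.2 ≠ i := by
  induction n with
  | zero =>
    obtain ⟨keep, drop, hadv, B, φ, hp, -⟩ := hf.exists_prunesTo hT
    obtain ⟨rs, rfl, hrs⟩ := (hf.isTournament_iff_of_prunesTo hp hadv).1 h
    simpa [isTournament_zero_iff.1 hrs] using hf.lt.ne'
  | succ n ih =>
    obtain ⟨keep, drop, hadv, B, φ, hp, hB⟩ := hf.exists_prunesTo hT
    obtain ⟨rs, rfl, hrs⟩ := (hf.isTournament_iff_of_prunesTo hp hadv).1 h
    obtain ⟨i', j', v', w', hf'⟩ := exists_isFirst hB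
    rw [List.forall_mem_cons, List.forall_mem_map]
    refine ⟨hf.lt.ne', fun q hq (hqi : drop.succAbove q.2 = i) => ?_⟩
    have hle := hf.succAbove_le hadv hp hf'
    rcases hadv with ⟨⟨u, hu, huj, hiu⟩, rfl, rfl⟩ | ⟨-, rfl, rfl⟩
    · obtain ⟨u, rfl⟩ := Fin.exists_succAbove_eq huj
      rw [← hqi, Fin.succAbove_lt_succAbove_iff] at hiu
      rw [← hqi, Fin.succAbove_le_succAbove_iff] at hle
      obtain ⟨v'', w'', hc⟩ := (hp.adj_third_iff hqi hiu.ne').1 hu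
      exact ih hB hf' hrs q hq ((hf'.le _ _ _ _ hiu hc).antisymm hle)
    · exact Fin.succAbove_ne _ _ hqi

theorem exists_winner_eq {T : TrivalentTree (n + 1)} (hT : T.ABShareVertex)
    {i j x : Label (n + 1)} {v w : T.V} (hf : T.IsFirst i j v w)
    {rs : List (Label (n + 1) × Label (n + 1))} (h : T.IsTournament rs) (hx : i < x) :
    ∃ p ∈ rs, p.2 = x := by
  induction n with
  | zero =>
    obtain ⟨keep, drop, hadv, B, φ, hp, -⟩ := hf.exists_prunesTo hT
    obtain ⟨rs, rfl, -⟩ := (hf.isTournament_iff_of_prunesTo hp hadv).1 h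
    have hi := hf.two_le hT
    have hij := hf.lt
    refine ⟨_, List.mem_cons_self, Fin.ext ?_⟩
    rw [Fin.lt_def] at hij hx
    dsimp only
    omega
  | succ n ih =>
    obtain ⟨keep, drop, hadv, B, φ, hp, hB⟩ := hf.exists_prunesTo hT
    obtain ⟨rs, rfl, hrs⟩ := (hf.isTournament_iff_of_prunesTo hp hadv).1 h
    by_cases hxj : x = j
    · exact ⟨_, List.mem_cons_self, hxj.symm⟩
    have hxd : x ≠ drop := by
      rcases hadv with ⟨-, rfl, rfl⟩ | ⟨-, rfl, rfl⟩
      exacts [hxj, hx.ne']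
    obtain ⟨x, rfl⟩ := Fin.exists_succAbove_eq hxd
    obtain ⟨i', j', v', w', hf'⟩ := exists_isFirst hB
    have hx' : i' < x :=
      Fin.succAbove_lt_succAbove_iff.1 ((hf.succAbove_le hadv hp hf').trans_lt hx)
    obtain ⟨q, hq, hqx⟩ := ih hB hf' hrs hx'
    exact ⟨_, List.mem_cons_of_mem _ (List.mem_map_of_mem hq), congrArg drop.succAbove hqx⟩

end IsFirst

end Rounds

section Tau

variable {n : ℕ} {A B : TrivalentTree n} {rs : List (Label n × Label n)}

/-- The class of a tree up to isomorphism. -/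
def toClass (A : TrivalentTree n) : TreeClass n := Quotient.mk _ A

theorem toClass_eq_iff : A.toClass = B.toClass ↔ A ≈ B := Quotient.eq

theorem exists_toClass_eq (T : TreeClass n) : ∃ A : TrivalentTree n, A.toClass = T :=
  Quotient.exists_rep T

theorem winsRound_iff (hA : A.ABShareVertex) (hrs : A.IsTournament rs) {j : Fin n} {m : ℕ} :
    A.toClass.WinsRound j m ↔ (rs.map Prod.snd)[m]? = some (num j) := by
  simp only [List.getElem?_map, Option.map_eq_some_iff, Prod.exists, exists_eq_right]
  constructor
  · rintro ⟨rs', hrs', h⟩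
    rwa [hrs.unique hA hrs']
  · exact fun h => ⟨rs, hrs, h⟩

theorem winsRound_tau (hA : A.ABShareVertex) (m : Fin n) :
    A.toClass.WinsRound (tau A.toClass m) m := by
  obtain ⟨rs, hrs⟩ := exists_isTournament hA
  have hm : m.val < rs.length := (hrs.length_eq hA).symm ▸ m.2
  obtain ⟨j, hj⟩ := exists_num_eq (hrs.three_le_winner hA _ (List.getElem_mem hm))
  exact Classical.epsilon_spec (p := fun j => A.toClass.WinsRound j m)
    ⟨j, (winsRound_iff hA hrs).2 (by simp [hm, hj])⟩

theorem tau_eq_iff (hA : A.ABShareVertex) {m j : Fin n} :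
    tau A.toClass m = j ↔ A.toClass.WinsRound j m := by
  refine ⟨fun h => h ▸ winsRound_tau hA m, fun h => ?_⟩
  obtain ⟨rs, hrs⟩ := exists_isTournament hA
  have hm := (winsRound_iff hA hrs).1 (winsRound_tau hA m)
  exact num_injective (Option.some.inj (hm.symm.trans ((winsRound_iff hA hrs).1 h)))

theorem map_snd_eq_ofFn_tau (hA : A.ABShareVertex) (hrs : A.IsTournament rs) :
    rs.map Prod.snd = List.ofFn fun m => num (tau A.toClass m) := by
  refine List.ext_getElem (by simp [hrs.length_eq hA]) fun m hm hm' => ?_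
  have h := (winsRound_iff hA hrs).1 (winsRound_tau hA ⟨m, by simpa using hm'⟩)
  rw [List.getElem?_eq_getElem hm, Option.some.injEq] at h
  rw [h, List.getElem_ofFn]

theorem height_tau (hA : A.ABShareVertex) (hrs : A.IsTournament rs) (c : Fin n) :
    (tau A.toClass).height c = rs.countP fun p => p.2 = num c := by
  have hsnd : (rs.countP fun p => p.2 = num c) = (rs.map Prod.snd).countP (· = num c) :=
    by rw [List.countP_map]; rfl
  rw [hsnd, map_snd_eq_ofFn_tau hA hrs, List.ofFn_eq_map, List.countP_map,
    List.countP_eq_length_filter]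
  simp only [Function.comp_def, num_injective.eq_iff]
  rfl

theorem toClass_mem_tour_iff {k : Fin n → ℕ} :
    A.toClass ∈ Tour k ↔ A.ABShareVertex ∧ (tau A.toClass).height = k := by
  refine and_congr_right fun hA => ?_
  obtain ⟨rs, hrs⟩ := exists_isTournament hA
  simp only [funext_iff, height_tau hA hrs]
  exact ⟨fun ⟨rs', hrs', h⟩ => hrs.unique hA hrs' ▸ h, fun h => ⟨rs, hrs, h⟩⟩

end Tau

section FirstRound

variable {n : ℕ} {A : TrivalentTree (n + 1)} {B : TrivalentTree n} {i : Label (n + 1)}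
  {j z : Fin (n + 1)} {v w : A.V} {φ : B.G ↪g A.G}

theorem tau_eq_cons (hA : A.ABShareVertex) (hB : B.ABShareVertex)
    {rs : List (Label n × Label n)} (hrs : B.IsTournament rs)
    (h : A.IsTournament ((i, num j) :: rs.map (Prod.map (num z).succAbove (num z).succAbove))) :
    tau A.toClass = Fin.cons j fun m => z.succAbove (tau B.toClass m) := by
  refine funext fun m => (tau_eq_iff hA).2 ((winsRound_iff hA h).2 ?_)
  refine Fin.cases rfl (fun m => ?_) m
  have hm := (winsRound_iff hB hrs).1 (winsRound_tau hB m)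
  rw [List.getElem?_map, Option.map_eq_some_iff] at hm
  obtain ⟨p, hp, hpm⟩ := hm
  simp [hp, hpm, succAbove_num]

namespace IsFirst

theorem tau_zero (hA : A.ABShareVertex) (hf : A.IsFirst i (num j) v w) : tau A.toClass 0 = j := by
  obtain ⟨rs, hrs⟩ := exists_isTournament hA
  obtain ⟨rs, rfl, -⟩ := hf.isTournament_iff.1 hrs
  exact (tau_eq_iff hA).2 ((winsRound_iff hA hrs).2 rfl)

theorem isLastZero (hA : A.ABShareVertex) {j : Label (n + 1)} (hf : A.IsFirst i j v w) :
    IsLastZero (tau A.toClass).height i := by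
  obtain ⟨rs, hrs⟩ := exists_isTournament hA
  refine ⟨hf.two_le hA, ?_, fun l hl => ?_⟩
  · rintro l rfl
    rw [height_tau hA hrs, List.countP_eq_zero]
    simpa using fun x y => hf.winner_ne hA hrs (x, y)
  · obtain ⟨p, hp, hpl⟩ := hf.exists_winner_eq hA hrs hl
    rw [height_tau hA hrs, ← Nat.pos_iff_ne_zero, List.countP_pos_iff]
    exact ⟨p, hp, by simpa using hpl⟩

theorem aboveZeros (hA : A.ABShareVertex) (hf : A.IsFirst i (num j) v w) :
    AboveZeros (tau A.toClass).height j :=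
  (hf.isLastZero hA).lt_num_iff.1 hf.lt

theorem winner_ne_of_loserAdvances {j : Label (n + 1)} (hf : A.IsFirst i j v w)
    (hadv : A.LoserAdvances w i j) {rs : List (Label (n + 1) × Label (n + 1))}
    (h : A.IsTournament ((i, j) :: rs)) : ∀ p ∈ rs, p.2 ≠ j := by
  obtain ⟨B, φ, hp⟩ := hf.cherry.exists_prunesTo
  obtain ⟨rs', he, -⟩ := (hf.isTournament_iff_of_prunesTo hp (Or.inl ⟨hadv, rfl, rfl⟩)).1 h
  rw [(List.cons.inj he).2, List.forall_mem_map]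
  exact fun q _ => Fin.succAbove_ne j q.2

theorem exists_isTournament_of_winner_ne {j : Label (n + 1)} (hf : A.IsFirst i j v w)
    (hp : A.PrunesTo v w i j B φ) {rs : List (Label (n + 1) × Label (n + 1))}
    (h : A.IsTournament ((i, j) :: rs)) (hrs : ∀ p ∈ rs, p.2 ≠ j) :
    ∃ rs', rs = rs'.map (Prod.map j.succAbove j.succAbove) ∧ B.IsTournament rs' := by
  by_cases hadv : A.LoserAdvances w i j
  · obtain ⟨rs', he, hB⟩ := (hf.isTournament_iff_of_prunesTo hp (Or.inl ⟨hadv, rfl, rfl⟩)).1 h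
    exact ⟨rs', (List.cons.inj he).2, hB⟩
  · exact hf.exists_isTournament_of_not_loserAdvances hp hadv h hrs

theorem exists_isTournament_of_winner_eq {j : Label (n + 1)} (hf : A.IsFirst i j v w)
    (hp : A.PrunesTo v w j i B φ) {rs : List (Label (n + 1) × Label (n + 1))}
    (h : A.IsTournament ((i, j) :: rs)) (hrs : ∃ p ∈ rs, p.2 = j) :
    ∃ rs', rs = rs'.map (Prod.map i.succAbove i.succAbove) ∧ B.IsTournament rs' := by
  obtain ⟨p, hpm, hpj⟩ := hrs
  have hadv : ¬A.LoserAdvances w i j := fun hl => hf.winner_ne_of_loserAdvances hl h p hpm hpj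
  obtain ⟨rs', he, hB⟩ := (hf.isTournament_iff_of_prunesTo hp (Or.inr ⟨hadv, rfl, rfl⟩)).1 h
  exact ⟨rs', (List.cons.inj he).2, hB⟩

theorem exists_isTournament {k : Fin (n + 1) → ℕ} (hT : A.toClass ∈ Tour k)
    (hf : A.IsFirst i (num j) v w) (hp : A.PrunesTo v w (kept k i j) (dropped k i j) B φ) :
    ∃ rs, A.IsTournament ((i, num j) ::
      rs.map (Prod.map (dropped k i j).succAbove (dropped k i j).succAbove)) ∧
      B.IsTournament rs := by
  obtain ⟨hA, rfl⟩ := toClass_mem_tour_iff.1 hT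
  obtain ⟨rs, hrs⟩ := TrivalentTree.exists_isTournament hA
  obtain ⟨rs, rfl, -⟩ := hf.isTournament_iff.1 hrs
  have hwins : 1 < (tau A.toClass).height j ↔ ∃ p ∈ rs, p.2 = num j := by
    rw [height_tau hA hrs, List.countP_cons_of_pos (by simp), Nat.lt_add_left_iff_pos,
      List.countP_pos_iff]
    simp only [decide_eq_true_eq]
  rcases kept_dropped_cases (tau A.toClass).height i j with ⟨hj, hk, hd⟩ | ⟨hj, hk, hd⟩ <;>
    rw [hk, hd] at hp <;> rw [hd]
  · obtain ⟨rs, rfl, hB⟩ := hf.exists_isTournament_of_winner_eq hp hrs (hwins.1 hj)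
    exact ⟨rs, hrs, hB⟩
  · rw [hwins] at hj
    push Not at hj
    obtain ⟨rs, rfl, hB⟩ := hf.exists_isTournament_of_winner_ne hp hrs hj
    exact ⟨rs, hrs, hB⟩

end IsFirst

end FirstRound

section PiLazy

variable {n : ℕ} {A : TrivalentTree (n + 1)} {B : TrivalentTree n} {k : Fin (n + 1) → ℕ}
  {i : Label (n + 1)} {j z : Fin (n + 1)} {v w : A.V} {φ : B.G ↪g A.G}

theorem exists_isFirst_num (hA : A.ABShareVertex) :
    ∃ (i : Label (n + 1)) (j : Fin (n + 1)) (v w : A.V), A.IsFirst i (num j) v w := by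
  obtain ⟨i, j, v, w, hf⟩ := exists_isFirst hA
  obtain ⟨j, rfl⟩ := exists_num_eq ((hf.two_le hA).trans_lt hf.lt)
  exact ⟨i, j, v, w, hf⟩

theorem isPruning_iff {keep drop : Label (n + 1)} (hc : A.IsCherry v w keep drop) :
    A.IsPruning v keep drop B ↔ ∃ φ, A.PrunesTo v w keep drop B φ :=
  ⟨fun ⟨φ, hr, hl⟩ => ⟨φ, hc, hr, hl⟩, fun ⟨φ, h⟩ => ⟨φ, h.range_eq, h.map_leaf⟩⟩

theorem PrunesTo.abShareVertex_iff_of_two_le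
    (hp : A.PrunesTo v w (kept k i j) (dropped k i j) B φ) (hi : 2 ≤ i.val) :
    B.ABShareVertex ↔ A.ABShareVertex := by
  have hj : 2 ≤ (num j).val := Nat.le_add_left_of_le (by omega)
  rcases kept_dropped_cases k i j with ⟨-, hk, hd⟩ | ⟨-, hk, hd⟩ <;> rw [hk, hd] at hp
  exacts [hp.abShareVertex_iff hj hi, hp.abShareVertex_iff hi hj]

namespace IsFirst

theorem isCherry_kept (hf : A.IsFirst i (num j) v w) (k : Fin (n + 1) → ℕ) :
    A.IsCherry v w (kept k i j) (dropped k i j) := by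
  unfold kept dropped
  split_ifs
  exacts [hf.cherry.symm, hf.cherry]

theorem r_tau (hT : A.toClass ∈ Tour k) (hf : A.IsFirst i (num j) v w)
    (hp : A.PrunesTo v w (kept k i j) (dropped k i j) B φ) :
    (tau A.toClass).r = tau B.toClass := by
  obtain ⟨rs, h, hrs⟩ := hf.exists_isTournament hT hp
  obtain ⟨hA, rfl⟩ := toClass_mem_tour_iff.1 hT
  obtain rfl := hf.tau_zero hA
  rw [Filling.dropped_eq_num_rightmostEmpty (hf.isLastZero hA) (hf.aboveZeros hA)] at h
  have hτ := tau_eq_cons hA ((hp.abShareVertex_iff_of_two_le (hf.two_le hA)).2 hA) hrs h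
  refine funext fun m => Fin.succAbove_right_injective ((Filling.succAbove_r _ m).trans ?_)
  exact congrFun hτ m.succ

theorem toClass_mem_tour (hT : A.toClass ∈ Tour k) (hf : A.IsFirst i (num j) v w)
    (hp : A.PrunesTo v w (kept k i j) (dropped k i j) B φ) : B.toClass ∈ Tour (tilde k j) := by
  have hr := hf.r_tau hT hp
  obtain ⟨hA, rfl⟩ := toClass_mem_tour_iff.1 hT
  refine toClass_mem_tour_iff.2 ⟨(hp.abShareVertex_iff_of_two_le (hf.two_le hA)).2 hA, ?_⟩
  rw [← hr, Filling.height_r, hf.tau_zero hA]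

theorem map {A' : TrivalentTree (n + 1)} {j : Label (n + 1)} (hf : A.IsFirst i j v w)
    (ψ : A.G ≃g A'.G) (hψ : ∀ x, ψ (A.leaf x) = A'.leaf x) : A'.IsFirst i j (ψ v) (ψ w) := by
  refine ⟨hf.lt, hf.cherry.map ψ hψ, fun v' w' i' j' h hc => hf.le _ _ _ _ h (hc.map ψ.symm ?_)⟩
  exact fun x => by rw [← hψ, RelIso.symm_apply_apply]

end IsFirst

theorem isPiLazy_iff : A.IsPiLazy k j B ↔ ∃ i v w, A.IsFirst i (num j) v w ∧
    ∃ φ, A.PrunesTo v w (kept k i j) (dropped k i j) B φ := by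
  have hpruning : ∀ i v,
      (if 1 < k j then A.IsPruning v (num j) i B else A.IsPruning v i (num j) B) ↔
        A.IsPruning v (kept k i j) (dropped k i j) B := fun i v => by
    unfold kept dropped
    split_ifs <;> rfl
  simp only [IsPiLazy, firstFaceOff_iff, hpruning, ← exists_and_right]
  exact exists_congr fun i => exists_congr fun v => exists_congr fun w =>
    and_congr_right fun hf => isPruning_iff (hf.isCherry_kept k)

theorem IsFirst.isPiLazy_toClass_iff (hf : A.IsFirst i (num j) v w)
    (hp : A.PrunesTo v w (kept k i j) (dropped k i j) B φ) {j' : Fin (n + 1)} {T' : TreeClass n} :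
    A.toClass.IsPiLazy k j' T' ↔ j' = j ∧ T' = B.toClass := by
  constructor
  · rintro ⟨A', B', hA, rfl, h⟩
    obtain ⟨ψ, hψ⟩ : A' ≈ A := Quotient.exact hA
    obtain ⟨i', v', w', hf', φ', hp'⟩ := isPiLazy_iff.1 h
    obtain ⟨rfl, hj, rfl, rfl⟩ := hf.unique (hf'.map ψ hψ)
    obtain rfl := num_injective hj
    exact ⟨rfl, Quotient.sound ((hp'.map ψ hψ).equiv hp)⟩
  · rintro ⟨rfl, rfl⟩
    exact ⟨A, B, rfl, rfl, isPiLazy_iff.2 ⟨i, v, w, hf, φ, hp⟩⟩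

end PiLazy

section Lift

variable {n : ℕ} {A : TrivalentTree (n + 1)} {B : TrivalentTree n} {i j : Label (n + 1)}
  {v w : A.V} {φ : B.G ↪g A.G}

namespace PrunesTo

theorem isFirst {keep drop : Label (n + 1)} (hp : A.PrunesTo v w keep drop B φ) (hij : i < j)
    (hkd : keep = i ∧ drop = j ∨ keep = j ∧ drop = i)
    (hle : ∀ v' w' x y, x < y → B.IsCherry v' w' x y → drop.succAbove x ≤ i) :
    A.IsFirst i j v w := by
  have hc : A.IsCherry v w i j := by
    rcases hkd with ⟨rfl, rfl⟩ | ⟨rfl, rfl⟩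
    exacts [hp.cherry, hp.cherry.symm]
  refine ⟨hij, hc, fun v' w' x y hxy hxyc => ?_⟩
  rcases hp.isCherry_cases hxyc with h | h | ⟨x, y, rfl, rfl, v'', w'', hc'⟩
  · grind
  · grind
  · exact hle _ _ _ _ (Fin.succAbove_lt_succAbove_iff.1 hxy) hc'

theorem not_loserAdvances (hp : A.PrunesTo v w j i B φ) (hij : i < j)
    (hle : ∀ v' w' x y, x < y → B.IsCherry v' w' x y → i.succAbove x ≤ i) :
    ¬A.LoserAdvances w i j := by
  rintro ⟨u, hu, huj, hiu⟩
  obtain ⟨u, rfl⟩ := Fin.exists_succAbove_eq hiu.ne'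
  obtain ⟨y, rfl⟩ := Fin.exists_succAbove_eq hij.ne'
  have huy : u ≠ y := fun h => huj (congrArg _ h)
  obtain ⟨v', w', hc⟩ := (hp.adj_third_iff rfl huy).1 hu
  rcases lt_or_gt_of_ne huy with h | h
  · exact hiu.not_ge (hle _ _ _ _ h hc.symm)
  · exact hij.not_ge (hle _ _ _ _ h hc)

end PrunesTo

theorem PrunesTo.loserAdvances {B : TrivalentTree (n + 1)} {A : TrivalentTree (n + 2)} {v w : A.V}
    {i j : Label (n + 2)} {φ : B.G ↪g A.G} (hp : A.PrunesTo v w i j B φ) {a b : Label (n + 1)}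
    {v' w' : B.V} (hf : B.IsFirst a b v' w') (ha : j.succAbove a = i) : A.LoserAdvances w i j :=
  ⟨j.succAbove b, (hp.adj_third_iff ha hf.lt.ne').2 ⟨v', w', hf.cherry⟩, Fin.succAbove_ne _ _,
    ha ▸ Fin.succAbove_lt_succAbove_iff.2 hf.lt⟩

end Lift

section ExistsTau

variable {n : ℕ} {P : Filling (n + 1)} {i : Label (n + 1)}

theorem succAbove_dropped_le_of_isCherry (hi : IsLastZero P.height i)
    (h0 : AboveZeros P.height (P 0)) {B : TrivalentTree n} (hB : B.ABShareVertex)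
    (hτ : tau B.toClass = P.r) {v w : B.V} {x y : Label n} (hxy : x < y) (hc : B.IsCherry v w x y) :
    (dropped P.height i (P 0)).succAbove x ≤ i := by
  rw [Filling.dropped_eq_num_rightmostEmpty hi h0]
  rcases n with _ | n
  · have hx : ((num P.rightmostEmpty).succAbove x).val ≤ x.val + 1 := by
      unfold Fin.succAbove
      split_ifs <;> simp
    have hxy' : x.val < y.val := hxy
    have := hi.two_le
    rw [Fin.le_def]
    omega
  · obtain ⟨a, b, v', w', hf⟩ := exists_isFirst hB
    exact (Fin.succAbove_le_succAbove_iff.2 (hf.le _ _ _ _ hxy hc)).trans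
      (Filling.succAbove_le_of_isLastZero hi h0 (hτ ▸ hf.isLastZero hB))

theorem firstAdvances_of_tau_eq_r {P : Filling (n + 2)} {i : Label (n + 2)}
    (hi : IsLastZero P.height i) (h0 : AboveZeros P.height (P 0)) {B : TrivalentTree (n + 1)}
    (hB : B.ABShareVertex) (hτ : tau B.toClass = P.r) {A : TrivalentTree (n + 2)} {v w : A.V}
    {φ : B.G ↪g A.G}
    (hp : A.PrunesTo v w (kept P.height i (P 0)) (dropped P.height i (P 0)) B φ) :
    A.FirstAdvances w i (num (P 0)) (kept P.height i (P 0)) (dropped P.height i (P 0)) := by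
  have hlt := hi.lt_num_iff.2 h0
  have hz := Filling.dropped_eq_num_rightmostEmpty hi h0
  have hle := fun v w x y => succAbove_dropped_le_of_isCherry (v := v) (w := w) (x := x) (y := y)
    hi h0 hB hτ
  obtain ⟨a, b, v', w', hf⟩ := exists_isFirst hB
  have ha : i ≠ num P.rightmostEmpty → (num P.rightmostEmpty).succAbove a = i := fun hne =>
    Filling.succAbove_eq_of_isLastZero hi h0 hne (hτ ▸ hf.isLastZero hB)
  rcases kept_dropped_cases P.height i (P 0) with ⟨-, hk, hd⟩ | ⟨-, hk, hd⟩
  · rw [hd] at hle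
    rw [hk, hd] at hp ⊢
    exact Or.inr ⟨hp.not_loserAdvances hlt hle, rfl, rfl⟩
  · rw [← hz, hd] at ha
    rw [hk, hd] at hp ⊢
    exact Or.inl ⟨hp.loserAdvances hf (ha hlt.ne), rfl, rfl⟩

/-- Grafting a cherry onto the leaf `kept` inverts the first round. -/
theorem exists_tau_eq (h0 : AboveZeros P.height (P 0)) {B : TrivalentTree n}
    (hB : B.ABShareVertex) (hτ : tau B.toClass = P.r) :
    ∃ A : TrivalentTree (n + 1), A.ABShareVertex ∧ tau A.toClass = P := by
  obtain ⟨i, hi⟩ := exists_isLastZero P.height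
  have hlt := hi.lt_num_iff.2 h0
  have hne : kept P.height i (P 0) ≠ dropped P.height i (P 0) := by
    rcases kept_dropped_cases P.height i (P 0) with ⟨-, hk, hd⟩ | ⟨-, hk, hd⟩ <;> rw [hk, hd]
    exacts [hlt.ne', hlt.ne]
  obtain ⟨A, v, w, φ, hp⟩ := exists_prunesTo B hne
  have hA := (hp.abShareVertex_iff_of_two_le hi.two_le).1 hB
  refine ⟨A, hA, ?_⟩
  rcases n with _ | n
  · exact funext fun _ => Subsingleton.elim (α := Fin 1) _ _
  have hkd := (kept_dropped_cases P.height i (P 0)).symm.imp And.right And.right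
  have hf := hp.isFirst hlt hkd fun v w x y =>
    succAbove_dropped_le_of_isCherry hi h0 hB hτ
  obtain ⟨rs, hrs⟩ := exists_isTournament hB
  have h := (hf.isTournament_iff_of_prunesTo hp (firstAdvances_of_tau_eq_r hi h0 hB hτ hp)).2
    ⟨rs, rfl, hrs⟩
  rw [Filling.dropped_eq_num_rightmostEmpty hi h0] at h
  rw [tau_eq_cons hA hB hrs h, hτ]
  exact funext (Fin.cases rfl P.succAbove_r)

end ExistsTau

section Tripod

/-- The tree with one internal vertex, the base case of the induction. -/
def tripod : TrivalentTree 0 where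
  V := Option (Label 0)
  finite := inferInstance
  G := SimpleGraph.starGraph none
  isTree := SimpleGraph.isTree_starGraph none
  degree
    | none => Or.inr (by simp [ncard_neighborSet_starGraph_self])
    | some x => Or.inl (ncard_neighborSet_starGraph_of_ne (Option.some_ne_none x))
  leaf := some
  leaf_injective := Option.some_injective _
  leaf_range
    | none => by simp [ncard_neighborSet_starGraph_self]
    | some x => by simp [ncard_neighborSet_starGraph_of_ne (Option.some_ne_none x)]

theorem tripod_equiv {A : TrivalentTree 0} : tripod ≈ A := by
  obtain ⟨v, hv⟩ := exists_adj_leaf (T := A) 0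
  have hne := ne_leaf_of_adj hv
  let f : Option (Label 0) → A.V := fun x => x.elim v A.leaf
  have hf : Function.Bijective f := by
    refine ⟨Option.injective_iff.2 ⟨A.leaf_injective, ?_⟩, fun u => ?_⟩
    · rintro ⟨x, hx⟩
      exact hne x hx.symm
    · by_cases hu : ∃ x, u = A.leaf x
      · obtain ⟨x, rfl⟩ := hu
        exact ⟨some x, rfl⟩
      · exact ⟨none, eq_of_ne_leaf hne (not_exists.1 hu)⟩
  refine ⟨⟨Equiv.ofBijective f hf, ?_⟩, fun _ => rfl⟩
  rintro (_ | x) (_ | y)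
  · exact iff_of_false (A.G.irrefl) (tripod.G.irrefl)
  · exact iff_of_true (adj_leaf_of_ne_leaf hne y) (by simp [tripod])
  · exact iff_of_true (adj_leaf_of_ne_leaf hne x).symm (by simp [tripod])
  · exact iff_of_false (not_adj_leaf_leaf x y) (by simp [tripod])

theorem abShareVertex_tripod : tripod.ABShareVertex :=
  ⟨none, by simp [tripod], by simp [tripod]⟩

end Tripod

end TrivalentTree

section Bijection

open TrivalentTree

theorem exists_prunesTo_of_mem_tour {n : ℕ} {k : Fin (n + 1) → ℕ} {T : TreeClass (n + 1)}
    (hT : T ∈ Tour k) :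
    ∃ (A : TrivalentTree (n + 1)) (B : TrivalentTree n) (i : Label (n + 1)) (j : Fin (n + 1))
      (v w : A.V) (φ : B.G ↪g A.G), A.toClass = T ∧ A.ABShareVertex ∧
        A.IsFirst i (num j) v w ∧ A.PrunesTo v w (kept k i j) (dropped k i j) B φ := by
  obtain ⟨A, rfl⟩ := exists_toClass_eq T
  have hA := (toClass_mem_tour_iff.1 hT).1
  obtain ⟨i, j, v, w, hf⟩ := exists_isFirst_num hA
  obtain ⟨B, φ, hp⟩ := (hf.isCherry_kept k).exists_prunesTo
  exact ⟨A, B, i, j, v, w, φ, rfl, hA, hf, hp⟩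

theorem tau_mapsTo {n : ℕ} (k : Fin n → ℕ) : Set.MapsTo tau (Tour k) (CPF k) := by
  induction n with
  | zero =>
    intro T _
    exact Filling.mem_CPF_iff.2 ⟨fun c => c.elim0, fun c => c.elim0, funext fun c => c.elim0⟩
  | succ n ih =>
    intro T hT
    obtain ⟨A, B, i, j, v, w, φ, rfl, hA, hf, hp⟩ := exists_prunesTo_of_mem_tour hT
    obtain ⟨-, rfl⟩ := toClass_mem_tour_iff.1 hT
    refine Filling.mem_CPF_succ_iff.2 ?_
    rw [hf.tau_zero hA, hf.r_tau hT hp]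
    exact ⟨hf.aboveZeros hA, ih _ (hf.toClass_mem_tour hT hp)⟩

theorem tau_injOn {n : ℕ} (k : Fin n → ℕ) : Set.InjOn tau (Tour k) := by
  induction n with
  | zero =>
    intro T _ T' _ _
    obtain ⟨A, rfl⟩ := exists_toClass_eq T
    obtain ⟨A', rfl⟩ := exists_toClass_eq T'
    exact toClass_eq_iff.2 (Setoid.trans (Setoid.symm tripod_equiv) tripod_equiv)
  | succ n ih =>
    intro T hT T' hT' h
    obtain ⟨A, B, i, j, v, w, φ, rfl, hA, hf, hp⟩ := exists_prunesTo_of_mem_tour hT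
    obtain ⟨A', B', i', j', v', w', φ', rfl, hA', hf', hp'⟩ := exists_prunesTo_of_mem_tour hT'
    obtain rfl : j = j' := by rw [← hf.tau_zero hA, ← hf'.tau_zero hA', h]
    obtain rfl := (hf.isLastZero hA).unique (h ▸ hf'.isLastZero hA')
    have hB : tau B.toClass = tau B'.toClass := by
      rw [← hf.r_tau hT hp, ← hf'.r_tau hT' hp', h]
    have hBB' := ih _ (hf.toClass_mem_tour hT hp) (hf'.toClass_mem_tour hT' hp') hB
    exact toClass_eq_iff.2 (hp.equiv_of_equiv hp' (toClass_eq_iff.1 hBB'))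

theorem tau_surjOn {n : ℕ} (k : Fin n → ℕ) : Set.SurjOn tau (Tour k) (CPF k) := by
  induction n with
  | zero =>
    exact fun P _ => ⟨tripod.toClass, toClass_mem_tour_iff.2
      ⟨abShareVertex_tripod, funext fun c => c.elim0⟩, funext fun c => c.elim0⟩
  | succ n ih =>
    intro P hP
    obtain ⟨-, -, rfl⟩ := Filling.mem_CPF_iff.1 hP
    obtain ⟨h0, hr⟩ := Filling.mem_CPF_succ_iff.1 hP
    obtain ⟨T, hT, hτ⟩ := ih _ hr
    obtain ⟨B, rfl⟩ := exists_toClass_eq T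
    obtain ⟨A, hA, rfl⟩ := exists_tau_eq h0 (toClass_mem_tour_iff.1 hT).1 hτ
    exact ⟨A.toClass, toClass_mem_tour_iff.2 ⟨hA, rfl⟩, rfl⟩

end Bijection

/-- The first part says that `τ` is a bijection from `Tour(k)` to `CPF(k)`. The second part is the
commutative square: `P ↦ (P 0, r P)`, where `P 0` is the column of car `1`, is the map `r̂` from
`CPF(k)` to the disjoint union of the `CPF(k̃_j)`, `j > i`; the relation `IsPiLazy k` is the graph of
a map `T ↦ (j, T')` from `Tour(k)` to the disjoint union of the `Tour(k̃_j)`, `j > i`; and `τ`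
intertwines the two maps. -/
theorem proposition4 :
    (∀ (n : ℕ) (k : Fin n → ℕ), ∑ l, k l = n →
      (∀ T ∈ Tour k, ∀ m j : Fin n, tau T m = j ↔ T.WinsRound j m) ∧
      Set.BijOn tau (Tour k) (CPF k)) ∧
    (∀ (n : ℕ) (k : Fin (n + 1) → ℕ), ∑ l, k l = n + 1 →
      (∀ P ∈ CPF k, AboveZeros k (P 0) ∧ P.r ∈ CPF (tilde k (P 0))) ∧
      (∀ T ∈ Tour k, ∃ (j : Fin (n + 1)) (T' : TreeClass n),
        (∀ j' T'', T.IsPiLazy k j' T'' ↔ j' = j ∧ T'' = T') ∧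
        AboveZeros k j ∧ T' ∈ Tour (tilde k j) ∧
        (tau T 0, (tau T).r) = (j, tau T'))) := by
  refine ⟨fun n k _ => ⟨fun T hT m j => ?_, tau_mapsTo k, tau_injOn k, tau_surjOn k⟩,
    fun n k _ => ⟨fun P hP => ?_, fun T hT => ?_⟩⟩
  · obtain ⟨A, rfl⟩ := TrivalentTree.exists_toClass_eq T
    exact TrivalentTree.tau_eq_iff (TrivalentTree.toClass_mem_tour_iff.1 hT).1
  · obtain ⟨-, -, rfl⟩ := Filling.mem_CPF_iff.1 hP
    exact Filling.mem_CPF_succ_iff.1 hP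
  · obtain ⟨A, B, i, j, v, w, φ, rfl, hA, hf, hp⟩ := exists_prunesTo_of_mem_tour hT
    obtain ⟨-, rfl⟩ := TrivalentTree.toClass_mem_tour_iff.1 hT
    exact ⟨j, B.toClass, fun _ _ => hf.isPiLazy_toClass_iff hp, hf.aboveZeros hA,
      hf.toClass_mem_tour hT hp, by rw [hf.tau_zero hA, hf.r_tau hT hp]⟩
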